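/- **Theorem (slow rate for bounded variation signals).** *Setting.* An interval of $[n]=\{1,\dots,n\}$ is a set $I=\{a,a+1,\dots,b\}$ with $1\le a\le b\le n$. For an integer $q\ge 0$, an interval $I$, $i\in I$ and $y\in\mathbb R^n$, let $(P^{(I,q)}y_I)_i$ be the entry at location $i$ of the orthogonal projection of $y_I=(y_j)_{j\in I}$ onto the space of vectors $(f(j/n))_{j\in I}$, $f$ a real polynomial of degree at most $q$. For intervals $I\subseteq J$ let $C_{I,J}=1$ if $I$ contains neither end point of $J$, $C_{I,J}=-1$ if $I=J$, and $C_{I,J}=0$ otherwise. For $\lambda\ge 0$, a Minmax Trend Filtering fit of order $q$ to $y$ is any vector $\hat\theta^{(q,\lambda)}\in\mathbb R^n$ such that for all $i\in[n]$ $$\max_{J\ni i}\ \min_{I:\, i\in I\subseteq J}\Big[(P^{(I,q)}y_I)_i+\frac{\lambda C_{I,J}}{|I|}\Big]\ \le\ \hat\theta^{(q,\lambda)}_i\ \le\ \min_{J\ni i}\ \max_{I:\, i\in I\subseteq J}\Big[(P^{(I,q)}y_I)_i-\frac{\lambda C_{I,J}}{|I|}\Big],$$ where $I,J$ range over intervals.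 For $r\ge 1$ let $TV^{(r)}(\theta)=n^{r-1}|D^{(r)}\theta|_1$, where $D^{(r)}\theta\in\mathbb R^{n-r}$ is the $r$-fold iterated first difference ($TV^{(r)}(\theta)=0$ if $n\le r$). *Claim.* For every integer $r\ge 1$ and all $\kappa,c_0,a>0$ there is a constant $C>0$, depending only on $r,\kappa,c_0,a$, with the following property. Let $n\ge 2$, $\sigma>0$, $\theta^*\in\mathbb R^n$, and $y=\theta^*+\epsilon$, where $\epsilon_1,\dots,\epsilon_n$ are independent (for instance i.i.d.) and $\sigma$-sub-Gaussian, that is, $\mathbb E e^{t\epsilon_i}\le e^{\sigma^2t^2/2}$ for all $t\in\mathbb R$. Let $V=TV^{(r)}(\theta^*)$, suppose that $V\ge c_0\,\sigma\log n/\sqrt n$, and put $$\lambda=\kappa\, n^{r/(2r+1)}\,V^{-1/(2r+1)}\,\sigma^{1+1/(2r+1)}\,(\log n)^{1/2+1/(2r+1)} .$$ Then with probability at least $1-n^{-a}$, simultaneously for all Minmax Trend Filtering fits $\hat\theta^{(r-1,\lambda)}$ of order $r-1$ to $y$, $$\frac1n\big\|\hat\theta^{(r-1,\lambda)}-\theta^*\big\|^2\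 \le\ C\,n^{-2r/(2r+1)}\,V^{2/(2r+1)}\,\big(\sigma^2(\log n)^2\big)^{2r/(2r+1)} .$$ -/

import Mathlib

open MeasureTheory ProbabilityTheory
open scoped NNReal ENNReal

noncomputable section

/-- A nonempty discrete interval `[a : b]`, `a ≤ b`, of `[n]`. The position `i ∈ {1, …, n}` is
represented by the index `i - 1 : Fin n`. The order `I ≤ J` on intervals is inclusion. -/
abbrev DInterval (n : ℕ) : Type := NonemptyInterval (Fin n)

instance DInterval.instFinite (n : ℕ) : Finite (DInterval n) :=
  Finite.of_injective _ NonemptyInterval.toProd_injective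

/-- The set of points of the interval. -/
def DInterval.points {n : ℕ} (I : DInterval n) : Finset (Fin n) := Finset.Icc I.fst I.snd

/-- The cardinality `|I|`. -/
def DInterval.len {n : ℕ} (I : DInterval n) : ℕ := I.points.card

/-- `S^(I,r)`: the restrictions to `I` of the vectors `(f(1/n), …, f(n/n))`, where `f` is a real
polynomial of degree at most `r`. -/
def polySubspace {n : ℕ} (r : ℕ) (I : DInterval n) : Submodule ℝ (EuclideanSpace ℝ I.points) where
  carrier := {v | ∃ f ∈ Polynomial.degreeLE ℝ (r : WithBot ℕ),
    ∀ j : I.points, v j = f.eval ((((j : Fin n) : ℕ) + 1 : ℝ) / (n : ℝ))}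
  zero_mem' := ⟨0, Submodule.zero_mem _, fun j => by simp⟩
  add_mem' := by
    rintro v w ⟨f, hf, hv⟩ ⟨g, hg, hw⟩
    exact ⟨f + g, Submodule.add_mem _ hf hg, fun j => by simp [hv j, hw j]⟩
  smul_mem' := by
    rintro c v ⟨f, hf, hv⟩
    exact ⟨c • f, Submodule.smul_mem _ c hf, fun j => by simp [hv j]⟩

/-- The restriction `v_I`. -/
def restrictTo {n : ℕ} (v : Fin n → ℝ) (I : DInterval n) : EuclideanSpace ℝ I.points :=
  WithLp.toLp 2 fun j => v j

/-- `(P^(|I|,r) y_I)_i`: the value at `i ∈ I` of the least squares polynomial fit of degree `r` to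
`y` on `I`, that is, of the orthogonal projection of `y_I` onto `S^(I,r)`
(with the unused value `0` for `i ∉ I`). -/
def polyFit {n : ℕ} (r : ℕ) (y : Fin n → ℝ) (I : DInterval n) (i : Fin n) : ℝ :=
  if h : i ∈ I.points then (polySubspace r I).starProjection (restrictTo y I) ⟨i, h⟩ else 0

/-- For `I ⊆ J`: `C_{I,J}` is `1` if `I` avoids both end points of `J`, `-1` if `I = J`, and `0`
otherwise. -/
def signC {n : ℕ} (I J : DInterval n) : ℝ :=
  if J.fst < I.fst ∧ I.snd < J.snd then 1 else if I = J then -1 else 0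

/-- The intervals containing `i`. -/
abbrev IntervalsAt {n : ℕ} (i : Fin n) : Type := {J : DInterval n // i ∈ J}

/-- The intervals `I` with `i ∈ I ⊆ J`. -/
abbrev SubintervalsAt {n : ℕ} (i : Fin n) (J : DInterval n) : Type :=
  {I : DInterval n // i ∈ I ∧ I ≤ J}

/-- `max_{J ∋ i} min_{I : i ∈ I ⊆ J} [(P^(|I|,r) y_I)_i + λ C_{I,J} / |I|]`.
The index types are finite and nonempty, so `⨆` and `⨅` are a maximum and a minimum. -/
def maxMin {n : ℕ} (r : ℕ) (lam : ℝ) (y : Fin n → ℝ) (i : Fin n) : ℝ :=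
  ⨆ J : IntervalsAt i, ⨅ I : SubintervalsAt i J.1,
    (polyFit r y I.1 i + lam * signC I.1 J.1 / (I.1.len : ℝ))

/-- `min_{J ∋ i} max_{I : i ∈ I ⊆ J} [(P^(|I|,r) y_I)_i - λ C_{I,J} / |I|]`. -/
def minMax {n : ℕ} (r : ℕ) (lam : ℝ) (y : Fin n → ℝ) (i : Fin n) : ℝ :=
  ⨅ J : IntervalsAt i, ⨆ I : SubintervalsAt i J.1,
    (polyFit r y I.1 i - lam * signC I.1 J.1 / (I.1.len : ℝ))

/-- `est` is a Minmax Trend Filtering fit of order `r` with tuning parameter `lam` to the data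
`y`: every entry lies between the max-min and the min-max bound. -/
def IsMinmaxTF {n : ℕ} (r : ℕ) (lam : ℝ) (y est : Fin n → ℝ) : Prop :=
  ∀ i, maxMin r lam y i ≤ est i ∧ est i ≤ minMax r lam y i

/-- The max-min bound never exceeds the min-max bound. -/
theorem maxMin_le_minMax {n : ℕ} (r : ℕ) {lam : ℝ} (hlam : 0 ≤ lam) (y : Fin n → ℝ) (i : Fin n) :
    maxMin r lam y i ≤ minMax r lam y i := by
  have : Nonempty (IntervalsAt i) := ⟨⟨NonemptyInterval.pure i, NonemptyInterval.mem_pure_self i⟩⟩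
  refine ciSup_le fun J => le_ciInf fun K => ?_
  obtain ⟨J, hJ⟩ := J
  obtain ⟨K, hK⟩ := K
  rw [NonemptyInterval.mem_def] at hJ hK
  let I : DInterval n := ⟨(max J.fst K.fst, min J.snd K.snd),
    (max_le hJ.1 hK.1).trans (le_min hJ.2 hK.2)⟩
  have hiI : i ∈ I := ⟨max_le hJ.1 hK.1, le_min hJ.2 hK.2⟩
  have hIJ : I ≤ J := ⟨le_max_left _ _, min_le_left _ _⟩
  have hIK : I ≤ K := ⟨le_max_right _ _, min_le_right _ _⟩
  refine (ciInf_le (Set.finite_range _).bddBelow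
    (⟨I, hiI, hIJ⟩ : SubintervalsAt i J)).trans (le_trans ?_
      (le_ciSup (Set.finite_range _).bddAbove (⟨I, hiI, hIK⟩ : SubintervalsAt i K)))
  have hsum : signC I J + signC I K ≤ 0 := by
    have e : ∀ L : DInterval n, I = L ↔ I.fst = L.fst ∧ I.snd = L.snd := fun L => by
      rw [NonemptyInterval.ext_iff, Prod.ext_iff]
    have h1 : I.fst = max J.fst K.fst := rfl
    have h2 : I.snd = min J.snd K.snd := rfl
    unfold signC
    simp only [e, h1, h2]
    split_ifs <;> grind
  have hlen : (0 : ℝ) ≤ (I.len : ℝ) := Nat.cast_nonneg _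
  have : lam * signC I J / (I.len : ℝ) + lam * signC I K / (I.len : ℝ) ≤ 0 := by
    rw [← add_div, ← mul_add]
    exact div_nonpos_of_nonpos_of_nonneg (mul_nonpos_of_nonneg_of_nonpos hlam hsum) hlen
  dsimp only
  linarith

/-- Minmax Trend Filtering is well defined. -/
theorem exists_isMinmaxTF {n : ℕ} (r : ℕ) {lam : ℝ} (hlam : 0 ≤ lam) (y : Fin n → ℝ) :
    ∃ est, IsMinmaxTF r lam y est :=
  ⟨minMax r lam y, fun i => ⟨maxMin_le_minMax r hlam y i, le_rfl⟩⟩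

/-- The first difference `D(v) = (v_2 - v_1, …, v_m - v_{m-1})`. -/
def diffVec {m : ℕ} (v : Fin m → ℝ) : Fin (m - 1) → ℝ := fun i =>
  v ⟨(i : ℕ) + 1, by have := i.isLt; omega⟩ - v ⟨(i : ℕ), by have := i.isLt; omega⟩

/-- The iterated difference `D^(r)(v) ∈ ℝ^(n-r)`. -/
def iterDiff {n : ℕ} (v : Fin n → ℝ) : (r : ℕ) → Fin (n - r) → ℝ
  | 0 => v
  | r + 1 => diffVec (iterDiff v r)

/-- `TV^(r)(v) = n^(r-1) |D^(r)(v)|_1`, for `r ≥ 1`. -/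
def totalVar {n : ℕ} (r : ℕ) (v : Fin n → ℝ) : ℝ :=
  (n : ℝ) ^ (r - 1) * ∑ i, |iterDiff v r i|

/-- The mean squared error `(1/n) ‖est - θ‖²`. -/
def meanSqErr {n : ℕ} (est θ : Fin n → ℝ) : ℝ := 1 / (n : ℝ) * ∑ i, (est i - θ i) ^ 2

end

/-! Write q = r − 1 and L = log n. At a point i, the least squares fit on I is linear in the data,
with weights whose squares sum to O(1/|I|), because a polynomial of bounded degree on a grid is
bounded by its root mean square (`exists_sq_eval_le`, `exists_polyFit_weights`). A union bound makes
the noise of all local fits O(σ√(L/|I|)) at once. The rest is deterministic, so it holds for all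
estimators simultaneously.

Fix i and let J be the window of radius ℓ around i, in both the max-min and the min-max bound
(`abs_sub_le_of_window`). On I ⊆ J the bias is at most of order ℓ^q times the sum of |D^(r)θ| inside
J, by Newton's formula. For I inside J the penalty λ/|I| absorbs the noise up to O(σ²L/λ). If I
reaches an end of J, then I is long or J is cut off by the boundary of [n]. The case I = J costs
λ/ℓ.

The radius adapts to i (`exists_scales`): ℓ_i is the largest radius up to h, with h about λ²/(σ²L),
whose bias is O(λ√L/ℓ_i). If ℓ_i < h, the next larger window carries much variation. A Vitali
argument with disjoint windows then gives Σ 1/ℓ_i² ≲ n/h² + h^q |D^(r)θ|₁/(λ√L). For the prescribed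
λ the resulting squared error is of order nσ⁴L³/λ², which is n times the claimed rate. The lower
bound on V ensures λ²/(σ²L) ≲ n. -/

/-! ### Newton's forward difference formula -/

open Finset in
theorem Nat.sum_range_choose_fixed (m k : ℕ) : ∑ j ∈ range m, j.choose k = m.choose (k + 1) := by
  induction m with
  | zero => simp
  | succ m ih => rw [sum_range_succ, ih, Nat.choose_succ_succ, add_comm]

open Finset in
/-- Newton's forward difference formula with a bound for the remainder. -/
theorem abs_sub_newton_le (q : ℕ) (f : ℕ → ℝ) (s m : ℕ) :
    |f (s + m) - ∑ k ∈ range (q + 1), (m.choose k : ℝ) * (fwdDiff 1)^[k] f s| ≤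
      (m : ℝ) ^ q * ∑ j ∈ range (m - q), |(fwdDiff 1)^[q + 1] f (s + j)| := by
  have tele : ∀ g : ℕ → ℝ, g (s + m) - g s = ∑ j ∈ range m, fwdDiff 1 g (s + j) := fun g => by
    simpa [fwdDiff, add_assoc] using (Finset.sum_range_sub (fun j => g (s + j)) m).symm
  induction q generalizing f m with
  | zero =>
    simp only [zero_add, sum_range_one, Nat.choose_zero_right, Nat.cast_one, one_mul,
      Function.iterate_zero, id_eq, pow_zero, Nat.sub_zero, Function.iterate_one]
    rw [tele f]
    exact abs_sum_le_sum_abs _ _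
  | succ q ih =>
    -- Telescoping reduces to the formula for the first difference: summing the binomials over j < m
    -- raises their lower index by one, and the k = 0 term is f s.
    have key : f (s + m) - ∑ k ∈ range (q + 1 + 1), (m.choose k : ℝ) * (fwdDiff 1)^[k] f s =
        ∑ j ∈ range m, (fwdDiff 1 f (s + j) -
          ∑ k ∈ range (q + 1), (j.choose k : ℝ) * (fwdDiff 1)^[k] (fwdDiff 1 f) s) := by
      rw [sum_sub_distrib, ← tele f, sum_comm, sum_range_succ']
      simp only [← sum_mul, ← Nat.cast_sum, Nat.sum_range_choose_fixed,
        Function.iterate_succ_apply]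
      simp
      ring
    rw [key]
    refine (abs_sum_le_sum_abs _ _).trans ?_
    have bound : ∀ j ∈ range m, |fwdDiff 1 f (s + j) -
        ∑ k ∈ range (q + 1), (j.choose k : ℝ) * (fwdDiff 1)^[k] (fwdDiff 1 f) s| ≤
        (m : ℝ) ^ q * ∑ j ∈ range (m - (q + 1)), |(fwdDiff 1)^[q + 1 + 1] f (s + j)| := by
      intro j hj
      rw [mem_range] at hj
      refine (ih (fwdDiff 1 f) j fun g => ?_).trans ?_
      · simpa [fwdDiff, add_assoc] using (Finset.sum_range_sub (fun j => g (s + j)) j).symm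
      · simp only [Function.iterate_succ_apply]
        refine mul_le_mul (pow_le_pow_left₀ (Nat.cast_nonneg _) (by exact_mod_cast hj.le) _)
          (sum_le_sum_of_subset_of_nonneg (range_mono (by omega)) fun _ _ _ => abs_nonneg _)
          (sum_nonneg fun _ _ => abs_nonneg _) (by positivity)
    refine (sum_le_sum bound).trans_eq ?_
    rw [sum_const, card_range, nsmul_eq_mul, pow_succ]
    ring

/-! ### Polynomials on consecutive integers -/

open Finset in
theorem Finset.sum_range_mul_eq {M : Type*} [AddCommMonoid M] (F : ℕ → M) (s p : ℕ) :
    ∑ m ∈ range (p * s), F m = ∑ k ∈ range p, ∑ t ∈ range s, F (k * s + t) := by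
  induction p with
  | zero => simp
  | succ p ih => rw [Nat.succ_mul, sum_range_add, ih, sum_range_succ]

open Finset Polynomial in
/-- A value of a Lagrange basis polynomial for equally spaced nodes. -/
theorem abs_eval_lagrange_basis_le {q s t N m₀ k : ℕ} {A : ℝ} (hs : 0 < s)
    (hA : (N : ℝ) ≤ A * s) (hm : m₀ < N) (ht : t + q * s < N) (hk : k ∈ range (q + 1)) :
    |(Lagrange.basis (range (q + 1)) (fun k : ℕ => ((k * s + t : ℕ) : ℝ)) k).eval (m₀ : ℝ)| ≤
      A ^ q := by
  have hs' : (0 : ℝ) < s := by exact_mod_cast hs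
  rw [Lagrange.basis, eval_prod, abs_prod]
  -- Each factor divides a distance at most N by the distance of two distinct nodes, which is at
  -- least s.
  have : ∀ j ∈ (range (q + 1)).erase k, |eval (m₀ : ℝ) (Lagrange.basisDivisor
      (((k * s + t : ℕ) : ℝ)) (((j * s + t : ℕ) : ℝ)))| ≤ A := by
    intro j hj
    obtain ⟨hjk, hj⟩ := mem_erase.1 hj
    rw [mem_range] at hj
    have hjs : j * s ≤ q * s := Nat.mul_le_mul_right _ (by omega)
    have h1 : |(m₀ : ℝ) - ((j * s + t : ℕ) : ℝ)| ≤ N := by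
      rw [abs_le]
      have a1 : ((j * s + t : ℕ) : ℝ) ≤ N := by exact_mod_cast (by omega : j * s + t ≤ N)
      have a2 : (m₀ : ℝ) ≤ N := by exact_mod_cast hm.le
      have a3 : (0 : ℝ) ≤ m₀ := Nat.cast_nonneg _
      have a4 : (0 : ℝ) ≤ ((j * s + t : ℕ) : ℝ) := Nat.cast_nonneg _
      constructor <;> linarith
    have h2 : (s : ℝ) ≤ |((k * s + t : ℕ) : ℝ) - ((j * s + t : ℕ) : ℝ)| := by
      have : ((k * s + t : ℕ) : ℝ) - ((j * s + t : ℕ) : ℝ) = ((k : ℤ) - (j : ℤ) : ℤ) * (s : ℝ) := by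
        push_cast; ring
      rw [this, abs_mul, Nat.abs_cast]
      have : (1 : ℝ) ≤ |(((k : ℤ) - (j : ℤ) : ℤ) : ℝ)| := by
        rw [← Int.cast_abs]
        have hz : (k : ℤ) - j ≠ 0 := by omega
        exact_mod_cast Int.one_le_abs hz
      nlinarith
    simp only [Lagrange.basisDivisor, eval_mul, eval_C, eval_sub, eval_X, abs_mul, abs_inv]
    rw [inv_mul_le_iff₀ (hs'.trans_le h2)]
    have hA0 : 0 ≤ A := by
      by_contra h
      have : (0 : ℝ) ≤ N := Nat.cast_nonneg _
      nlinarith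
    calc _ ≤ (N : ℝ) := h1
      _ ≤ A * s := hA
      _ ≤ _ := by rw [mul_comm]; gcongr
  refine (prod_le_prod (fun _ _ => abs_nonneg _) this).trans_eq ?_
  rw [prod_const, card_erase_of_mem hk, card_range, Nat.add_sub_cancel]

open Finset Polynomial in
/-- On `N` consecutive integers, a polynomial of bounded degree is bounded by a multiple of its
root mean square. -/
theorem exists_sq_eval_le (q : ℕ) : ∃ K : ℝ, 1 ≤ K ∧ ∀ g : ℝ[X], g.natDegree ≤ q →
    ∀ N m₀ : ℕ, m₀ < N → g.eval (m₀ : ℝ) ^ 2 ≤ K / N * ∑ m ∈ range N, g.eval (m : ℝ) ^ 2 := by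
  set A : ℝ := 2 * (q + 1) with hA
  have hA1 : 1 ≤ A := by have : (0 : ℝ) ≤ q := Nat.cast_nonneg _; linarith
  have hB1 : 1 ≤ (A ^ q) ^ 2 := one_le_pow₀ (one_le_pow₀ hA1)
  have hq1 : (1 : ℝ) ≤ q + 1 := by have : (0 : ℝ) ≤ q := Nat.cast_nonneg _; linarith
  have hKq : (q : ℝ) + 1 ≤ A * ((q + 1) * (A ^ q) ^ 2) := by
    calc (q : ℝ) + 1 = 1 * ((q + 1) * 1) := by ring
      _ ≤ _ := by gcongr
  refine ⟨A * ((q + 1) * (A ^ q) ^ 2), hq1.trans hKq, ?_⟩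
  intro g hg N m₀ hm
  have hN : (0 : ℝ) < N := by exact_mod_cast (by omega : 0 < N)
  rw [div_mul_eq_mul_div, le_div_iff₀ hN]
  have hsum0 : 0 ≤ ∑ m ∈ range N, g.eval (m : ℝ) ^ 2 := sum_nonneg fun _ _ => sq_nonneg _
  rcases Nat.lt_or_ge q N with hqN | hqN
  -- The first (q + 1)s integers split into s progressions of step s. Interpolation on each one
  -- controls the value at m₀, and averaging over them gains the factor 1/N.
  · set s := N / (q + 1) with hs
    have hs0 : 0 < s := Nat.div_pos hqN (by omega)
    have hsN : (q + 1) * s ≤ N := Nat.mul_div_le _ _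
    have hNA : (N : ℝ) ≤ A * s := by
      have h1 : N < (q + 1) * (s + 1) := by
        rw [hs]; exact Nat.lt_mul_div_succ N (by omega)
      have h2 : N ≤ 2 * (q + 1) * s := by nlinarith
      rw [hA]; exact_mod_cast h2
    have step : ∀ t ∈ range s, g.eval (m₀ : ℝ) ^ 2 ≤
        ((q + 1) * (A ^ q) ^ 2) * ∑ k ∈ range (q + 1), g.eval ((k * s + t : ℕ) : ℝ) ^ 2 := by
      intro t ht
      rw [mem_range] at ht
      have hinj : Set.InjOn (fun k : ℕ => ((k * s + t : ℕ) : ℝ)) (range (q + 1)) := by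
        intro a _ b _ hab
        have : a * s + t = b * s + t := by
          dsimp only at hab
          exact_mod_cast hab
        exact Nat.eq_of_mul_eq_mul_right hs0 (by omega)
      have hdeg : g.degree < #(range (q + 1)) := by
        rw [card_range]
        exact degree_le_natDegree.trans_lt (by exact_mod_cast Nat.lt_succ_of_le hg)
      have hrep := Lagrange.eq_interpolate hinj hdeg
      have hev : g.eval (m₀ : ℝ) = ∑ k ∈ range (q + 1), g.eval ((k * s + t : ℕ) : ℝ) *
          (Lagrange.basis (range (q + 1)) (fun k : ℕ => ((k * s + t : ℕ) : ℝ)) k).eval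
            (m₀ : ℝ) := by
        conv_lhs => rw [hrep]
        simp [Lagrange.interpolate_apply, eval_finsetSum]
      rw [hev]
      refine (sum_mul_sq_le_sq_mul_sq _ _ _).trans ?_
      rw [mul_comm]
      refine mul_le_mul_of_nonneg_right ?_ (sum_nonneg fun _ _ => sq_nonneg _)
      have hb : ∀ k ∈ range (q + 1), (Lagrange.basis (range (q + 1))
          (fun k : ℕ => ((k * s + t : ℕ) : ℝ)) k).eval (m₀ : ℝ) ^ 2 ≤ (A ^ q) ^ 2 := by
        intro k hk
        rw [← sq_abs]
        refine pow_le_pow_left₀ (abs_nonneg _)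
          (abs_eval_lagrange_basis_le hs0 hNA hm ?_ hk) 2
        nlinarith
      refine (sum_le_sum hb).trans_eq ?_
      simp
    have h1 := sum_le_sum step
    rw [sum_const, card_range, nsmul_eq_mul, ← mul_sum, sum_comm,
      ← sum_range_mul_eq (fun m => g.eval (m : ℝ) ^ 2)] at h1
    have h2 : ∑ m ∈ range ((q + 1) * s), g.eval (m : ℝ) ^ 2 ≤ ∑ m ∈ range N, g.eval (m : ℝ) ^ 2 :=
      sum_le_sum_of_subset_of_nonneg (range_mono hsN) fun _ _ _ => sq_nonneg _
    calc g.eval (m₀ : ℝ) ^ 2 * N ≤ g.eval (m₀ : ℝ) ^ 2 * (A * s) := by gcongr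
      _ = A * (s * g.eval (m₀ : ℝ) ^ 2) := by ring
      _ ≤ A * (((q + 1) * (A ^ q) ^ 2) * ∑ m ∈ range ((q + 1) * s), g.eval (m : ℝ) ^ 2) := by
        gcongr
      _ ≤ A * (((q + 1) * (A ^ q) ^ 2) * ∑ m ∈ range N, g.eval (m : ℝ) ^ 2) := by gcongr
      _ = _ := by ring
  · have h1 : g.eval (m₀ : ℝ) ^ 2 ≤ ∑ m ∈ range N, g.eval (m : ℝ) ^ 2 :=
      single_le_sum (f := fun m : ℕ => g.eval (m : ℝ) ^ 2) (fun _ _ => sq_nonneg _)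
        (mem_range.2 hm)
    have h2 : (N : ℝ) ≤ q + 1 := by
      have : (N : ℝ) ≤ q := by exact_mod_cast hqN
      linarith
    calc _ ≤ (∑ m ∈ range N, g.eval (m : ℝ) ^ 2) * (q + 1) := by gcongr
      _ ≤ (∑ m ∈ range N, g.eval (m : ℝ) ^ 2) * (A * ((q + 1) * (A ^ q) ^ 2)) := by gcongr
      _ = _ := by ring

/-! ### Local fits as linear functionals -/

theorem DInterval.mem_points {n : ℕ} {I : DInterval n} {i : Fin n} :
    i ∈ I.points ↔ I.fst ≤ i ∧ i ≤ I.snd := Finset.mem_Icc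

theorem DInterval.fst_le_snd' {n : ℕ} (I : DInterval n) : (I.fst : ℕ) ≤ I.snd := I.fst_le_snd

theorem DInterval.len_eq {n : ℕ} (I : DInterval n) : I.len = I.snd + 1 - I.fst := by
  simp [DInterval.len, DInterval.points]

theorem DInterval.len_pos {n : ℕ} (I : DInterval n) : 0 < I.len := by
  have := I.fst_le_snd'
  rw [I.len_eq]; omega

theorem DInterval.sum_points {n : ℕ} (I : DInterval n) (F : ℕ → ℝ) :
    ∑ j ∈ I.points, F j = ∑ m ∈ Finset.range I.len, F (I.fst + m) := by
  rw [I.len_eq, ← Finset.sum_Ico_eq_sum_range]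
  have h := Fin.map_valEmbedding_Icc I.fst I.snd
  have h2 : Finset.Ico (I.fst : ℕ) (I.snd + 1) = Finset.Icc (I.fst : ℕ) I.snd := by
    ext; simp
  rw [h2, ← h, Finset.sum_map]
  rfl

open Polynomial in
/-- Vectors in `polySubspace q I` are bounded by a multiple of their root mean square. -/
theorem exists_sq_apply_le_of_mem_polySubspace (q : ℕ) : ∃ K : ℝ, 1 ≤ K ∧
    ∀ (n : ℕ) (I : DInterval n) (v : EuclideanSpace ℝ I.points), v ∈ polySubspace q I →
      ∀ i, v i ^ 2 ≤ K / I.len * ∑ j, v j ^ 2 := by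
  obtain ⟨K, hK1, hK⟩ := exists_sq_eval_le q
  refine ⟨K, hK1, fun n I v ⟨f, hf, hv⟩ i => ?_⟩
  have hfd : f.natDegree ≤ q := natDegree_le_of_degree_le (mem_degreeLE.1 hf)
  set g : ℝ[X] := f.comp (C (1 / (n : ℝ)) * X + C (((I.fst : ℕ) + 1 : ℝ) / n)) with hg
  have hgd : g.natDegree ≤ q := by
    refine natDegree_comp_le.trans ?_
    calc f.natDegree * _ ≤ f.natDegree * 1 := Nat.mul_le_mul_left _ (natDegree_linear_le)
      _ ≤ q := by omega
  have hge : ∀ m : ℕ, g.eval (m : ℝ) = f.eval ((((I.fst : ℕ) + m : ℕ) + 1 : ℝ) / n) := by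
    intro m
    rw [hg, eval_comp]
    congr 1
    simp only [eval_add, eval_mul, eval_C, eval_X]
    push_cast
    ring
  have hi := DInterval.mem_points.1 i.2
  have hi1 : (I.fst : ℕ) ≤ (i : Fin n) := hi.1
  have hi2 : ((i : Fin n) : ℕ) ≤ I.snd := hi.2
  have hmain := hK g hgd I.len ((i : Fin n) - I.fst : ℕ) (by rw [I.len_eq]; omega)
  rw [hge, Nat.add_sub_cancel' hi1] at hmain
  have hs : ∑ j, v j ^ 2 = ∑ m ∈ Finset.range I.len, g.eval (m : ℝ) ^ 2 := by
    simp only [hge, hv]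
    rw [← I.sum_points (fun k => f.eval ((k + 1 : ℝ) / n) ^ 2)]
    exact Finset.sum_coe_sort I.points (fun j => f.eval (((j : ℕ) + 1 : ℝ) / n) ^ 2)
  rw [hs, hv]
  exact hmain

/-- The local polynomial fit at a point is a linear functional of the data with weights whose sum
of squares is of order `1 / |I|`. -/
theorem exists_polyFit_weights (q : ℕ) : ∃ K : ℝ, 1 ≤ K ∧
    ∀ (n : ℕ) (I : DInterval n) (i : Fin n), i ∈ I.points → ∃ w : Fin n → ℝ,
      (∀ y, polyFit q y I i = ∑ j ∈ I.points, w j * y j) ∧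
        ∑ j ∈ I.points, w j ^ 2 ≤ K / I.len := by
  obtain ⟨K, hK1, hK⟩ := exists_sq_apply_le_of_mem_polySubspace q
  refine ⟨K, hK1, fun n I i hi => ?_⟩
  set e : EuclideanSpace ℝ I.points := EuclideanSpace.single ⟨i, hi⟩ 1 with he
  set p := (polySubspace q I).starProjection e with hp
  have hpm : p ∈ polySubspace q I := Submodule.starProjection_apply_mem _ _
  have key : ∀ u, (polySubspace q I).starProjection u ⟨i, hi⟩ = ∑ j, p j * u j := by
    intro u
    have h1 : inner ℝ e ((polySubspace q I).starProjection u) =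
        (polySubspace q I).starProjection u ⟨i, hi⟩ := by
      rw [he, EuclideanSpace.inner_single_left]; simp
    rw [← h1, ← Submodule.inner_starProjection_left_eq_right, ← hp, PiLp.inner_apply]
    exact Finset.sum_congr rfl fun j _ => by simp [mul_comm]
  -- Idempotence gives p_i = ‖p‖². Inserted into p_i² ≤ (K/|I|)‖p‖², this leaves ‖p‖² ≤ K/|I|.
  have hpp : p ⟨i, hi⟩ = ∑ j, p j ^ 2 := by
    have := key p
    rw [Submodule.starProjection_eq_self_iff.2 hpm] at this
    rw [this]
    exact Finset.sum_congr rfl fun j _ => by ring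
  have hlen : (0 : ℝ) < I.len := by exact_mod_cast I.len_pos
  have hpK : ∑ j, p j ^ 2 ≤ K / I.len := by
    have h := hK n I p hpm ⟨i, hi⟩
    rw [hpp] at h
    have h0 : 0 ≤ ∑ j, p j ^ 2 := Finset.sum_nonneg fun _ _ => sq_nonneg _
    rcases h0.eq_or_lt with h0 | h0
    · rw [← h0]; positivity
    · rw [sq] at h
      exact le_of_mul_le_mul_right h h0
  refine ⟨fun j => if h : j ∈ I.points then p ⟨j, h⟩ else 0, fun y => ?_, ?_⟩
  · rw [polyFit, dif_pos hi, key]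
    refine Eq.trans ?_ (Finset.sum_coe_sort I.points _)
    exact Finset.sum_congr rfl fun j _ => by simp [restrictTo]
  · refine le_of_eq_of_le ((Finset.sum_coe_sort I.points _).symm.trans <|
      Finset.sum_congr rfl fun j _ => ?_) hpK
    simp

theorem polyFit_add {n : ℕ} (q : ℕ) (x y : Fin n → ℝ) (I : DInterval n) (i : Fin n) :
    polyFit q (fun j => x j + y j) I i = polyFit q x I i + polyFit q y I i := by
  unfold polyFit
  split_ifs with h
  · have : restrictTo (fun j => x j + y j) I = restrictTo x I + restrictTo y I := by
      ext j; simp [restrictTo]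
    rw [this, map_add]; rfl
  · simp

open Polynomial in
theorem polyFit_eval {n : ℕ} {q : ℕ} {f : ℝ[X]} (hf : f ∈ degreeLE ℝ (q : WithBot ℕ))
    {I : DInterval n} {i : Fin n} (hi : i ∈ I.points) :
    polyFit q (fun j => f.eval (((j : ℕ) + 1 : ℝ) / n)) I i = f.eval (((i : ℕ) + 1 : ℝ) / n) := by
  have hm : restrictTo (fun j : Fin n => f.eval (((j : ℕ) + 1 : ℝ) / n)) I ∈ polySubspace q I :=
    ⟨f, hf, fun j => rfl⟩
  rw [polyFit, dif_pos hi, Submodule.starProjection_eq_self_iff.2 hm]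
  rfl

/-- Weights with sum of squares at most `K / |I|` act boundedly in the supremum norm. -/
theorem abs_weighted_sum_le {n : ℕ} {I : DInterval n} {w y : Fin n → ℝ} {K b : ℝ}
    (hb : 0 ≤ b) (hw : ∑ j ∈ I.points, w j ^ 2 ≤ K / I.len) (hy : ∀ j ∈ I.points, |y j| ≤ b) :
    |∑ j ∈ I.points, w j * y j| ≤ √K * b := by
  have hlen : (0 : ℝ) < I.len := by exact_mod_cast I.len_pos
  have hK : 0 ≤ K / I.len := (Finset.sum_nonneg fun _ _ => sq_nonneg _).trans hw
  have h2 : ∑ j ∈ I.points, y j ^ 2 ≤ I.len * b ^ 2 := by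
    refine (Finset.sum_le_sum fun j hj => (sq_abs (y j)).symm.le.trans
      (pow_le_pow_left₀ (abs_nonneg _) (hy j hj) 2)).trans_eq ?_
    rw [Finset.sum_const, nsmul_eq_mul]; rfl
  have h3 : (∑ j ∈ I.points, w j * y j) ^ 2 ≤ K * b ^ 2 :=
    calc _ ≤ (∑ j ∈ I.points, w j ^ 2) * ∑ j ∈ I.points, y j ^ 2 :=
        Finset.sum_mul_sq_le_sq_mul_sq _ _ _
      _ ≤ K / I.len * (I.len * b ^ 2) := by
        gcongr
      _ = K * b ^ 2 := by field_simp
  calc _ ≤ √(K * b ^ 2) := Real.abs_le_sqrt h3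
    _ = √K * b := by rw [Real.sqrt_mul' _ (sq_nonneg b), Real.sqrt_sq hb]

/-! ### Bias of local fits -/

/-- The extension of a vector to a sequence by zeros. -/
def extendZero {n : ℕ} (v : Fin n → ℝ) (j : ℕ) : ℝ := if h : j < n then v ⟨j, h⟩ else 0

theorem extendZero_val {n : ℕ} (v : Fin n → ℝ) (i : Fin n) : extendZero v i = v i := by
  simp [extendZero]

/-- The padding zeros are never read: for j < n − r the difference involves only the positions j, …,
j + r. -/
theorem iterDiff_eq_fwdDiff {n : ℕ} (v : Fin n → ℝ) (r : ℕ) (j : Fin (n - r)) :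
    iterDiff v r j = (fwdDiff 1)^[r] (extendZero v) j := by
  induction r with
  | zero => exact (extendZero_val v j).symm
  | succ r ih =>
    rw [Function.iterate_succ_apply']
    simp only [iterDiff, diffVec, fwdDiff, ih]

theorem totalVar_eq_sum_range {n : ℕ} (q : ℕ) (v : Fin n → ℝ) : totalVar (q + 1) v =
    (n : ℝ) ^ q * ∑ j ∈ Finset.range (n - (q + 1)), |(fwdDiff 1)^[q + 1] (extendZero v) j| := by
  rw [totalVar, Nat.add_sub_cancel, Finset.sum_range]
  simp only [iterDiff_eq_fwdDiff]

/-- The sum of `d` over the stencils `{j, …, j + q + 1}` inside `[n]` and inside the window of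
radius `ℓ - 1` around `i`. -/
def localVar (q n : ℕ) (d : ℕ → ℝ) (i ℓ : ℕ) : ℝ :=
  ∑ j ∈ Finset.range (n - (q + 1)) with i < j + ℓ ∧ j + q + 1 < i + ℓ, d j

/-- The interval of radius `ℓ - 1` around `i`, cut off at the end points of `[n]`. -/
def window {n : ℕ} (i : Fin n) (ℓ : ℕ) : DInterval n :=
  ⟨(⟨i - (ℓ - 1), by omega⟩, ⟨min (i + (ℓ - 1)) (n - 1), by omega⟩), by
    rw [Fin.le_def]
    simp only
    omega⟩

theorem window_fst {n : ℕ} (i : Fin n) (ℓ : ℕ) : ((window i ℓ).fst : ℕ) = i - (ℓ - 1) := rfl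

theorem window_snd {n : ℕ} (i : Fin n) (ℓ : ℕ) :
    ((window i ℓ).snd : ℕ) = min (i + (ℓ - 1)) (n - 1) := rfl

theorem mem_window {n : ℕ} (i : Fin n) (ℓ : ℕ) : i ∈ window i ℓ := by
  rw [NonemptyInterval.mem_def, Fin.le_def, Fin.le_def, window_fst, window_snd]
  omega

open Polynomial in
/-- The polynomial, in the variable `(j + 1) / n`, of Newton's forward difference formula. -/
theorem exists_newton_polynomial {n : ℕ} (hn : 0 < n) (q s : ℕ) (c : ℕ → ℝ) :
    ∃ f ∈ degreeLE ℝ (q : WithBot ℕ), ∀ m : ℕ,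
      f.eval (((s + m : ℕ) + 1 : ℝ) / n) =
        ∑ k ∈ Finset.range (q + 1), (m.choose k : ℝ) * c k := by
  have hn' : (n : ℝ) ≠ 0 := by exact_mod_cast hn.ne'
  refine ⟨(∑ k ∈ Finset.range (q + 1), C (c k / (k.factorial : ℝ)) * descPochhammer ℝ k).comp
    (C (n : ℝ) * X + C (-(s + 1 : ℝ))), ?_, fun m => ?_⟩
  · rw [mem_degreeLE]
    refine degree_le_natDegree.trans ?_
    have h1 : (∑ k ∈ Finset.range (q + 1),
        C (c k / (k.factorial : ℝ)) * descPochhammer ℝ k).natDegree ≤ q := by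
      refine natDegree_sum_le_of_forall_le _ _ fun k hk => ?_
      refine (natDegree_C_mul_le _ _).trans ?_
      rw [descPochhammer_natDegree]
      exact Nat.lt_succ_iff.1 (Finset.mem_range.1 hk)
    have h2 := (natDegree_comp_le (p := ∑ k ∈ Finset.range (q + 1),
      C (c k / (k.factorial : ℝ)) * descPochhammer ℝ k)
      (q := C (n : ℝ) * X + C (-(s + 1 : ℝ)))).trans
      (Nat.mul_le_mul h1 natDegree_linear_le)
    rw [mul_one] at h2
    exact_mod_cast h2
  · have hx : eval (((s + m : ℕ) + 1 : ℝ) / n) (C (n : ℝ) * X + C (-(s + 1 : ℝ))) = (m : ℝ) := by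
      simp only [eval_add, eval_mul, eval_C, eval_X]
      push_cast
      field_simp
      ring
    rw [eval_comp, hx, eval_finsetSum]
    refine Finset.sum_congr rfl fun k _ => ?_
    rw [eval_mul, eval_C, descPochhammer_eval_eq_descFactorial,
      Nat.descFactorial_eq_factorial_mul_choose]
    have : (k.factorial : ℝ) ≠ 0 := by exact_mod_cast k.factorial_ne_zero
    push_cast
    field_simp

open Polynomial in
/-- The bias of the local polynomial fit is controlled by the local variation. -/
theorem abs_polyFit_sub_le {n q ℓ : ℕ} {K : ℝ} {θ : Fin n → ℝ} {I : DInterval n} {i : Fin n}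
    (hI : I ≤ window i ℓ) (hi : i ∈ I.points)
    (hw : ∃ w : Fin n → ℝ, (∀ y, polyFit q y I i = ∑ j ∈ I.points, w j * y j) ∧
      ∑ j ∈ I.points, w j ^ 2 ≤ K / I.len) :
    |polyFit q θ I i - θ i| ≤ (√K + 1) * ((2 * ℓ : ℝ) ^ q *
      localVar q n (fun j => |(fwdDiff 1)^[q + 1] (extendZero θ) j|) i ℓ) := by
  set d : ℕ → ℝ := fun j => |(fwdDiff 1)^[q + 1] (extendZero θ) j| with hd
  set b : ℝ := (2 * ℓ : ℝ) ^ q * localVar q n d i ℓ with hb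
  have hn : 0 < n := i.pos
  have hlv : 0 ≤ localVar q n d i ℓ := Finset.sum_nonneg fun _ _ => abs_nonneg _
  have hb0 : 0 ≤ b := by positivity
  -- The fit reproduces the Newton polynomial of θ at the left end of I, so only the remainder
  -- contributes to the bias.
  obtain ⟨f, hf, hfe⟩ := exists_newton_polynomial hn q I.fst
    (fun k => (fwdDiff 1)^[k] (extendZero θ) I.fst)
  obtain ⟨w, hw1, hw2⟩ := hw
  have h1 : (i : ℕ) - (ℓ - 1) ≤ I.fst := hI.1
  have h2 : (I.snd : ℕ) ≤ min (i + (ℓ - 1)) (n - 1) := hI.2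
  have happrox : ∀ j ∈ I.points, |θ j - f.eval (((j : ℕ) + 1 : ℝ) / n)| ≤ b := by
    intro j hj
    obtain ⟨hj1, hj2⟩ := DInterval.mem_points.1 hj
    rw [Fin.le_def] at hj1 hj2
    obtain ⟨m, hm⟩ := Nat.exists_eq_add_of_le hj1
    have e1 : θ j = extendZero θ (I.fst + m) := by rw [← hm, extendZero_val]
    rw [e1, hm, hfe]
    refine (abs_sub_newton_le q (extendZero θ) I.fst m).trans ?_
    refine mul_le_mul (pow_le_pow_left₀ (Nat.cast_nonneg _) ?_ _) ?_
      (Finset.sum_nonneg fun _ _ => abs_nonneg _) (by positivity)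
    · exact_mod_cast (by omega : m ≤ 2 * ℓ)
    · refine (Finset.sum_map (Finset.range (m - q)) (addLeftEmbedding (I.fst : ℕ))
        d).symm.trans_le ?_
      refine Finset.sum_le_sum_of_subset_of_nonneg ?_ fun _ _ _ => abs_nonneg _
      intro k hk
      simp only [Finset.mem_map, Finset.mem_range, addLeftEmbedding_apply] at hk
      obtain ⟨a, ha, rfl⟩ := hk
      rw [Finset.mem_filter, Finset.mem_range]
      omega
  have hdec : polyFit q θ I i - θ i =
      ∑ j ∈ I.points, w j * (θ j - f.eval (((j : ℕ) + 1 : ℝ) / n)) -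
        (θ i - f.eval (((i : ℕ) + 1 : ℝ) / n)) := by
    have := polyFit_add q (fun j : Fin n => θ j - f.eval (((j : ℕ) + 1 : ℝ) / n))
      (fun j : Fin n => f.eval (((j : ℕ) + 1 : ℝ) / n)) I i
    simp only [sub_add_cancel] at this
    rw [this, polyFit_eval hf hi, hw1]
    ring
  rw [hdec]
  refine (abs_sub _ _).trans ?_
  have := abs_weighted_sum_le hb0 hw2 happrox
  have := happrox i hi
  linarith

/-! ### Pointwise error bound -/

/-- An interval `J` on which the fits are close to `t` up to the penalty localizes the
estimate. -/
theorem abs_sub_le_of_isMinmaxTF {n q : ℕ} {lam : ℝ} {y est : Fin n → ℝ}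
    (hest : IsMinmaxTF q lam y est) {i : Fin n} {J : DInterval n} (hiJ : i ∈ J) {t B : ℝ}
    (h : ∀ I : DInterval n, i ∈ I → I ≤ J →
      |polyFit q y I i - t| ≤ lam * signC I J / (I.len : ℝ) + B) : |est i - t| ≤ B := by
  obtain ⟨h1, h2⟩ := hest i
  have : Nonempty (SubintervalsAt i J) := ⟨⟨J, hiJ, le_rfl⟩⟩
  have hlo : t - B ≤ maxMin q lam y i := by
    refine le_trans ?_ (le_ciSup (Set.finite_range _).bddAbove (⟨J, hiJ⟩ : IntervalsAt i))
    refine le_ciInf fun I => ?_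
    have := (abs_le.1 (h I.1 I.2.1 I.2.2)).1
    dsimp only
    linarith
  have hhi : minMax q lam y i ≤ t + B := by
    refine (ciInf_le (Set.finite_range _).bddBelow (⟨J, hiJ⟩ : IntervalsAt i)).trans ?_
    refine ciSup_le fun I => ?_
    have := (abs_le.1 (h I.1 I.2.1 I.2.2)).2
    dsimp only
    linarith
  rw [abs_le]
  constructor <;> linarith

/-- The pointwise error bound. -/
theorem abs_sub_le_of_window {n q ℓ : ℕ} {lam N b : ℝ} (hlam : 0 < lam) (hN : 0 ≤ N)
    {θ ε est : Fin n → ℝ} (hest : IsMinmaxTF q lam (fun j => θ j + ε j) est) {i : Fin n}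
    (hℓ1 : 1 ≤ ℓ) (hℓn : ℓ ≤ n)
    (hbias : ∀ I : DInterval n, i ∈ I.points → I ≤ window i ℓ → |polyFit q θ I i - θ i| ≤ b)
    (hnoise : ∀ I : DInterval n, i ∈ I.points → |polyFit q ε I i| ≤ N * √(1 / I.len)) :
    |est i - θ i| ≤ b + N ^ 2 / lam + lam / ℓ +
      N * √(1 / ℓ + 1 / ((i : ℕ) + 1 : ℝ) + 1 / ((n : ℝ) - (i : ℕ))) := by
  refine abs_sub_le_of_isMinmaxTF hest (mem_window i ℓ) fun I hiI hIJ => ?_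
  have hi := DInterval.mem_points.2 (NonemptyInterval.mem_def.1 hiI)
  have hi' := DInterval.mem_points.1 hi
  have hf1 : (I.fst : ℕ) ≤ i := hi'.1
  have hf2 : (i : ℕ) ≤ I.snd := hi'.2
  have hin := i.isLt
  have hni : (0 : ℝ) < (n : ℝ) - (i : ℕ) := by
    have : ((i : ℕ) : ℝ) < n := by exact_mod_cast hin
    linarith
  have hℓ0 : (0 : ℝ) < ℓ := by exact_mod_cast hℓ1
  have hlen : (0 : ℝ) < I.len := by exact_mod_cast I.len_pos
  set R : ℝ := 1 / ℓ + 1 / ((i : ℕ) + 1 : ℝ) + 1 / ((n : ℝ) - (i : ℕ)) with hR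
  have p1 : (0 : ℝ) < 1 / ℓ := by positivity
  have p2 : (0 : ℝ) < 1 / ((i : ℕ) + 1 : ℝ) := by positivity
  have p3 : (0 : ℝ) < 1 / ((n : ℝ) - (i : ℕ)) := by positivity
  have hlenI := I.len_eq
  -- An I reaching an end of the window has length at least ℓ, unless that end is cut off by the
  -- boundary of [n]; then the length is at least i + 1 or n − i.
  have hroot : (ℓ ≤ I.len ∨ (i : ℕ) + 1 ≤ I.len ∨ n - i ≤ I.len) → √(1 / I.len) ≤ √R := by
    intro h
    refine Real.sqrt_le_sqrt ?_
    rcases h with h | h | h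
    · have : (1 : ℝ) / I.len ≤ 1 / ℓ := one_div_le_one_div_of_le hℓ0 (by exact_mod_cast h)
      linarith
    · have : (1 : ℝ) / I.len ≤ 1 / ((i : ℕ) + 1 : ℝ) :=
        one_div_le_one_div_of_le (by positivity) (by exact_mod_cast h)
      linarith
    · have : (1 : ℝ) / I.len ≤ 1 / ((n : ℝ) - (i : ℕ)) := by
        refine one_div_le_one_div_of_le hni ?_
        rw [← Nat.cast_sub hin.le]
        exact_mod_cast h
      linarith
  have hq1 : 0 ≤ N ^ 2 / lam := by positivity
  have hq2 : 0 ≤ lam / ℓ := by positivity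
  have hq3 : 0 ≤ N * √R := by positivity
  have htri : |polyFit q (fun j => θ j + ε j) I i - θ i| ≤ b + N * √(1 / I.len) := by
    rw [polyFit_add]
    have e : polyFit q θ I i + polyFit q ε I i - θ i =
      (polyFit q θ I i - θ i) + polyFit q ε I i := by ring
    rw [e]
    exact (abs_add_le _ _).trans (add_le_add (hbias I hi hIJ) (hnoise I hi))
  refine htri.trans ?_
  unfold signC
  split_ifs with hc1 hc2
  · set x := √(1 / (I.len : ℝ)) with hx
    have hx2 : x ^ 2 = 1 / I.len := Real.sq_sqrt (by positivity)
    -- Interior I: the penalty is λx² with x² = 1/|I|, and completing the square absorbs Nx.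
    have h1 : N * x ≤ lam * 1 / I.len + N ^ 2 / lam := by
      have e : lam * 1 / I.len = lam * x ^ 2 := by rw [hx2]; ring
      rw [e]
      have e2 : lam * x ^ 2 + N ^ 2 / lam - N * x =
          ((lam * x - N / 2) ^ 2 + 3 / 4 * N ^ 2) / lam := by
        field_simp
        ring
      have : 0 ≤ ((lam * x - N / 2) ^ 2 + 3 / 4 * N ^ 2) / lam := by positivity
      linarith
    linarith
  -- Even a window cut off at the boundary keeps ℓ points, since ℓ ≤ n.
  · have hℓI : ℓ ≤ I.len := by
      rw [hc2, DInterval.len_eq, window_fst, window_snd]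
      omega
    have h1 : lam / I.len ≤ lam / ℓ :=
      div_le_div_of_nonneg_left hlam.le hℓ0 (by exact_mod_cast hℓI)
    have h2 := mul_le_mul_of_nonneg_left (hroot (Or.inl hℓI)) hN
    have e : lam * -1 / (I.len : ℝ) = -(lam / I.len) := by ring
    rw [e]
    linarith
  · have h1 : ((window i ℓ).fst : ℕ) ≤ I.fst := hIJ.1
    have h2 : (I.snd : ℕ) ≤ (window i ℓ).snd := hIJ.2
    rw [not_and_or, not_lt, not_lt, Fin.le_def, Fin.le_def] at hc1
    rw [window_fst, window_snd] at *
    have h3 := mul_le_mul_of_nonneg_left (hroot (by omega)) hN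
    simp only [mul_zero, zero_div]
    linarith

/-! ### Covering argument and choice of radii -/

-- Telescoping, by 1/x² ≤ 1/(x − 1) − 1/x.
open Finset in
theorem sum_range_inv_add_sq_le {ρ : ℝ} (hρ : 1 < ρ) (n : ℕ) :
    ∑ k ∈ range n, 1 / (ρ + k) ^ 2 ≤ 1 / (ρ - 1) := by
  have h : ∀ n : ℕ, ∑ k ∈ range n, 1 / (ρ + k) ^ 2 ≤ 1 / (ρ - 1) - 1 / (ρ - 1 + n) := by
    intro n
    induction n with
    | zero => simp
    | succ n ih =>
      rw [sum_range_succ]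
      have hn : (0 : ℝ) ≤ n := Nat.cast_nonneg _
      have p1 : 0 < ρ - 1 + n := by linarith
      have p2 : 0 < ρ + n := by linarith
      have : 1 / (ρ + n) ^ 2 ≤ 1 / (ρ - 1 + n) - 1 / (ρ + n) := by
        rw [div_sub_div _ _ p1.ne' p2.ne', div_le_div_iff₀ (by positivity) (by positivity)]
        nlinarith
      have e : ρ - 1 + ((n + 1 : ℕ) : ℝ) = ρ + n := by push_cast; ring
      rw [e]
      linarith
  refine (h n).trans (sub_le_self _ ?_)
  have : (0 : ℝ) ≤ n := Nat.cast_nonneg _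
  have : 0 < ρ - 1 := by linarith
  positivity

-- On either side of j the distance to j is injective, so each value is taken at most twice.
open Finset in
theorem sum_range_abs_sub_le {F : ℕ → ℝ} (hF : ∀ k, 0 ≤ F k) (n j : ℕ) :
    ∑ i ∈ range n, F (Nat.dist i j) ≤ 2 * ∑ k ∈ range (n + j), F k := by
  have h1 : ∑ i ∈ range n with i ≤ j, F (Nat.dist i j) ≤ ∑ k ∈ range (n + j), F k := by
    by_cases hn : n = 0
    · subst hn; simpa using sum_nonneg fun k _ => hF k
    rw [← sum_image (f := F) (g := fun i => Nat.dist i j)]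
    · refine sum_le_sum_of_subset_of_nonneg (fun k hk => ?_) fun k _ _ => hF k
      simp only [mem_image, mem_filter, mem_range, Nat.dist] at hk ⊢
      obtain ⟨a, ha, rfl⟩ := hk
      omega
    · intro a ha b hb hab
      simp only [coe_filter, mem_range, Set.mem_ofPred_eq, Nat.dist] at ha hb hab
      omega
  have h2 : ∑ i ∈ range n with ¬ i ≤ j, F (Nat.dist i j) ≤ ∑ k ∈ range (n + j), F k := by
    rw [← sum_image (f := F) (g := fun i => Nat.dist i j)]
    · refine sum_le_sum_of_subset_of_nonneg (fun k hk => ?_) fun k _ _ => hF k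
      simp only [mem_image, mem_filter, mem_range, Nat.dist] at hk ⊢
      obtain ⟨a, ha, rfl⟩ := hk
      omega
    · intro a ha b hb hab
      simp only [coe_filter, mem_range, Set.mem_ofPred_eq, Nat.dist] at ha hb hab
      omega
  rw [← sum_filter_add_sum_filter_not (range n) (fun i => i ≤ j)]
  linarith

open Finset in
/-- A covering argument: if every point `i` of `t` has a ball of radius `ρ i`, the sum of
`1 / ρ ^ 2` over `t` is controlled by a subfamily of disjoint balls. -/
theorem exists_disjoint_sum_inv_sq_le {n : ℕ} (t : Finset ℕ) (htn : t ⊆ range n) (ρ : ℕ → ℕ)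
    (hρ : ∀ i ∈ t, 2 ≤ ρ i) : ∃ u ⊆ t,
      (u : Set ℕ).PairwiseDisjoint (fun i => {k : ℕ | i < k + ρ i ∧ k < i + ρ i}) ∧
        ∑ i ∈ t, 1 / (ρ i : ℝ) ^ 2 ≤ 100 * ∑ j ∈ u, 1 / (ρ j : ℝ) := by
  classical
  -- The size function 1/ρ makes the selection prefer small balls: every ball i meets a selected
  -- ball j with ρ j ≤ 2 ρ i.
  obtain ⟨u, hut, hdis, hcov⟩ := Vitali.exists_disjoint_subfamily_covering_enlargement
    (fun i => {k : ℕ | i < k + ρ i ∧ k < i + ρ i}) (t : Set ℕ) (fun i => 1 / (ρ i : ℝ)) 2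
    (by norm_num) (fun i _ => by positivity) 1 (fun i hi => by
      have : 2 ≤ ρ i := hρ i hi
      have : (1 : ℝ) ≤ ρ i := by exact_mod_cast (by omega : 1 ≤ ρ i)
      rw [div_le_one (by linarith)]; exact this)
    (fun i hi => ⟨i, by
      have : 2 ≤ ρ i := hρ i hi
      simp only [Set.mem_ofPred_eq]
      omega⟩)
  have hfin : u.Finite := t.finite_toSet.subset hut
  lift u to Finset ℕ using hfin
  rw [Finset.coe_subset] at hut
  refine ⟨u, hut, hdis, ?_⟩
  have hterm : ∀ i ∈ t, 1 / (ρ i : ℝ) ^ 2 ≤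
      ∑ j ∈ u, 25 * (1 / ((ρ j : ℝ) + (Nat.dist i j : ℕ)) ^ 2) := by
    intro i hi
    obtain ⟨j, hj, ⟨k, hk1, hk2⟩, hle⟩ := hcov i hi
    have hi2 := hρ i hi
    have hj2 := hρ j (hut hj)
    have hle' : ρ j ≤ 2 * ρ i := by
      have a1 : (0 : ℝ) < ρ i := by exact_mod_cast (by omega : 0 < ρ i)
      have a2 : (0 : ℝ) < ρ j := by exact_mod_cast (by omega : 0 < ρ j)
      rw [mul_one_div, div_le_div_iff₀ a1 a2] at hle
      have : (ρ j : ℝ) ≤ 2 * ρ i := by linarith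
      exact_mod_cast this
    simp only [Set.mem_ofPred_eq] at hk1 hk2
    -- Intersecting balls have |i − j| < ρ i + ρ j ≤ 3 ρ i.
    have hd : ρ j + Nat.dist i j ≤ 5 * ρ i := by
      simp only [Nat.dist]; omega
    have hd' : (ρ j : ℝ) + (Nat.dist i j : ℕ) ≤ 5 * ρ i := by exact_mod_cast hd
    have hpos : (0 : ℝ) < (ρ j : ℝ) + (Nat.dist i j : ℕ) := by
      exact_mod_cast (by omega : 0 < ρ j + Nat.dist i j)
    have hpos' : (0 : ℝ) < ρ i := by linarith
    refine le_trans ?_ (single_le_sum (f := fun j => 25 * (1 / ((ρ j : ℝ) +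
      (Nat.dist i j : ℕ)) ^ 2)) (fun _ _ => by positivity) hj)
    rw [mul_one_div, div_le_div_iff₀ (by positivity) (by positivity)]
    nlinarith
  calc _ ≤ ∑ i ∈ range n, ∑ j ∈ u, 25 * (1 / ((ρ j : ℝ) + (Nat.dist i j : ℕ)) ^ 2) :=
      (sum_le_sum hterm).trans (sum_le_sum_of_subset_of_nonneg htn fun _ _ _ =>
        sum_nonneg fun _ _ => by positivity)
    _ = ∑ j ∈ u, 25 * ∑ i ∈ range n, 1 / ((ρ j : ℝ) + (Nat.dist i j : ℕ)) ^ 2 := by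
      rw [sum_comm]; simp only [mul_sum]
    _ ≤ ∑ j ∈ u, 100 * (1 / (ρ j : ℝ)) := by
      -- The sum over i is at most 2/(ρ j − 1) ≤ 4/ρ j, whence 100 = 25 · 4.
      refine sum_le_sum fun j hj => ?_
      have hj2 : (2 : ℝ) ≤ ρ j := by exact_mod_cast hρ j (hut hj)
      have h1 := sum_range_abs_sub_le (F := fun k => 1 / ((ρ j : ℝ) + k) ^ 2)
        (fun _ => by positivity) n j
      have h2 := sum_range_inv_add_sq_le (ρ := ρ j) (by linarith) (n + j)
      have h3 : 1 / ((ρ j : ℝ) - 1) ≤ 2 * (1 / (ρ j : ℝ)) := by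
        rw [mul_one_div, div_le_div_iff₀ (by linarith) (by linarith)]
        linarith
      linarith
    _ = _ := by rw [mul_sum]

-- A one-point window contains no stencil of q + 2 points, so radius 1 is always admissible in the
-- choice of scales.
open Finset in
theorem localVar_one (q n : ℕ) (d : ℕ → ℝ) (i : ℕ) : localVar q n d i 1 = 0 := by
  rw [localVar, filter_false_of_mem, sum_empty]
  intro j _
  omega

open Finset in
/-- The choice of scales: radii on which the variation is small, most of them of order `h`. -/
theorem exists_scales {q n h : ℕ} {d : ℕ → ℝ} {μ : ℝ} (hd : ∀ j, 0 ≤ d j) (hμ : 0 < μ)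
    (hh : 1 ≤ h) : ∃ ℓ : ℕ → ℕ,
      (∀ i, 1 ≤ ℓ i ∧ ℓ i ≤ h ∧ (ℓ i : ℝ) ^ (q + 1) * localVar q n d i (ℓ i) ≤ μ) ∧
      ∑ i ∈ range n, 1 / (ℓ i : ℝ) ^ 2 ≤ n / (h : ℝ) ^ 2 +
        400 * (2 * ((h : ℝ) - 1)) ^ q * (∑ j ∈ range (n - (q + 1)), d j) / μ := by
  classical
  let P : ℕ → ℕ → Prop := fun i m => 1 ≤ m ∧ (m : ℝ) ^ (q + 1) * localVar q n d i m ≤ μ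
  have hP1 : ∀ i, P i 1 := fun i => ⟨le_rfl, by rw [localVar_one, mul_zero]; exact hμ.le⟩
  set ℓ : ℕ → ℕ := fun i => Nat.findGreatest (P i) h with hℓ
  have hspec : ∀ i, P i (ℓ i) := fun i => Nat.findGreatest_spec hh (hP1 i)
  have hle : ∀ i, ℓ i ≤ h := fun i => Nat.findGreatest_le _
  refine ⟨ℓ, fun i => ⟨(hspec i).1, hle i, (hspec i).2⟩, ?_⟩
  set t : Finset ℕ := (range n).filter fun i => ℓ i < h with ht
  -- ℓ i + 1 is inadmissible by maximality, so these balls carry large local variation.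
  obtain ⟨u, hut, hdis, hsum⟩ := exists_disjoint_sum_inv_sq_le t (filter_subset _ _)
    (fun i => ℓ i + 1) (fun i _ => by have := (hspec i).1; omega)
  have hh1 : (0 : ℝ) ≤ (h : ℝ) - 1 := by
    have : (1 : ℝ) ≤ h := by exact_mod_cast hh
    linarith
  have hgood : ∑ i ∈ range n with ¬ ℓ i < h, 1 / (ℓ i : ℝ) ^ 2 ≤ n / (h : ℝ) ^ 2 := by
    have : ∀ i ∈ (range n).filter (fun i => ¬ ℓ i < h), 1 / (ℓ i : ℝ) ^ 2 = 1 / (h : ℝ) ^ 2 := by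
      intro i hi
      rw [le_antisymm (hle i) (not_lt.1 (mem_filter.1 hi).2)]
    rw [sum_congr rfl this, sum_const, nsmul_eq_mul, mul_one_div]
    gcongr
    exact (card_filter_le _ _).trans_eq (card_range n)
  have hbad : ∑ i ∈ t, 1 / (ℓ i : ℝ) ^ 2 ≤ 4 * ∑ i ∈ t, 1 / ((ℓ i + 1 : ℕ) : ℝ) ^ 2 := by
    rw [mul_sum]
    refine sum_le_sum fun i _ => ?_
    have h1 : (1 : ℝ) ≤ ℓ i := by exact_mod_cast (hspec i).1
    push_cast
    rw [mul_one_div, div_le_div_iff₀ (by positivity) (by positivity)]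
    nlinarith
  have hu : ∀ j ∈ u, 1 / ((ℓ j + 1 : ℕ) : ℝ) ≤
      (2 * ((h : ℝ) - 1)) ^ q / μ * localVar q n d j (ℓ j + 1) := by
    intro j hj
    have hjh : ℓ j < h := (mem_filter.1 (hut hj)).2
    have hnot : ¬ P j (ℓ j + 1) := Nat.findGreatest_is_greatest (Nat.lt_succ_self _) hjh
    have hbig : μ < ((ℓ j + 1 : ℕ) : ℝ) ^ (q + 1) * localVar q n d j (ℓ j + 1) := by
      by_contra hcon
      exact hnot ⟨by omega, not_lt.1 hcon⟩
    have hpos : (0 : ℝ) < ((ℓ j + 1 : ℕ) : ℝ) := by positivity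
    have hlv : 0 ≤ localVar q n d j (ℓ j + 1) := sum_nonneg fun _ _ => hd _
    -- Here h ≥ 2. The form 2(h − 1) is kept because rounding H up to h gives h − 1 ≤ H for every H
    -- > 0, however small.
    have hℓh : ((ℓ j + 1 : ℕ) : ℝ) ≤ 2 * ((h : ℝ) - 1) := by
      have a1 : ((ℓ j + 1 : ℕ) : ℝ) ≤ h := by exact_mod_cast hjh
      have a2 : (2 : ℝ) ≤ h := by
        have := (hspec j).1
        exact_mod_cast (by omega : 2 ≤ h)
      linarith
    rw [div_mul_eq_mul_div, div_le_div_iff₀ hpos hμ, one_mul]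
    calc μ ≤ ((ℓ j + 1 : ℕ) : ℝ) ^ q * localVar q n d j (ℓ j + 1) * ((ℓ j + 1 : ℕ) : ℝ) := by
          rw [pow_succ] at hbig; linarith
      _ ≤ _ := by gcongr
  have hsumu : ∑ j ∈ u, localVar q n d j (ℓ j + 1) ≤ ∑ j ∈ range (n - (q + 1)), d j := by
    simp only [localVar]
    rw [← sum_biUnion]
    · refine sum_le_sum_of_subset_of_nonneg (biUnion_subset.2 fun j _ => filter_subset _ _)
        fun _ _ _ => hd _
    · intro a ha b hb hab
      rw [Function.onFun, disjoint_left]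
      intro k hka hkb
      rw [mem_filter] at hka hkb
      have hdisj := hdis ha hb hab
      rw [Function.onFun, Set.disjoint_left] at hdisj
      -- The first point of a counted stencil lies in the ball, so disjoint balls count disjoint
      -- sets of stencils.
      exact @hdisj k
        (show a < k + (ℓ a + 1) ∧ k < a + (ℓ a + 1) by omega)
        (show b < k + (ℓ b + 1) ∧ k < b + (ℓ b + 1) by omega)
  rw [← sum_filter_add_sum_filter_not (range n) (fun i => ℓ i < h)]
  have hfin : ∑ i ∈ t, 1 / (ℓ i : ℝ) ^ 2 ≤
      400 * (2 * ((h : ℝ) - 1)) ^ q * (∑ j ∈ range (n - (q + 1)), d j) / μ :=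
    calc _ ≤ 4 * (100 * ∑ j ∈ u, 1 / ((ℓ j + 1 : ℕ) : ℝ)) := by linarith
      _ ≤ 4 * (100 * ∑ j ∈ u, (2 * ((h : ℝ) - 1)) ^ q / μ * localVar q n d j (ℓ j + 1)) := by
        gcongr with j hj
        exact hu j hj
      _ = 400 * ((2 * ((h : ℝ) - 1)) ^ q / μ * ∑ j ∈ u, localVar q n d j (ℓ j + 1)) := by
        rw [← mul_sum]; ring
      _ ≤ 400 * ((2 * ((h : ℝ) - 1)) ^ q / μ * ∑ j ∈ range (n - (q + 1)), d j) := by gcongr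
      _ = _ := by ring
  linarith

/-! ### Uniform control of the noise -/

theorem ProbabilityTheory.HasSubgaussianMGF.mono {Ω : Type*} {mΩ : MeasurableSpace Ω}
    {μ : Measure Ω} {X : Ω → ℝ} {c c' : ℝ≥0} (h : HasSubgaussianMGF X c μ) (hc : c ≤ c') :
    HasSubgaussianMGF X c' μ where
  integrable_exp_mul := h.integrable_exp_mul
  mgf_le t := (h.mgf_le t).trans <| by
    have : (c : ℝ) ≤ c' := by exact_mod_cast hc
    gcongr

/-- Two-sided tail bound for a linear combination of independent sub-Gaussian variables. -/
theorem measure_abs_weighted_sum_gt_le {Ω : Type*} [MeasurableSpace Ω] {μ : Measure Ω}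
    [IsProbabilityMeasure μ] {ι : Type*} {σ : ℝ≥0} {ε : ι → Ω → ℝ} (hind : iIndepFun ε μ)
    (hε : ∀ i, HasSubgaussianMGF (ε i) (σ ^ 2) μ) (s : Finset ι) (w : ι → ℝ) {c t : ℝ}
    (hc : σ ^ 2 * ∑ i ∈ s, w i ^ 2 ≤ c) (ht : 0 ≤ t) :
    μ {ω | t < |∑ i ∈ s, w i * ε i ω|} ≤ ENNReal.ofReal (2 * Real.exp (-t ^ 2 / (2 * c))) := by
  have hc0 : 0 ≤ c := le_trans (mul_nonneg (sq_nonneg _)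
    (Finset.sum_nonneg fun _ _ => sq_nonneg _)) hc
  have hind' : iIndepFun (fun i ω => w i * ε i ω) μ :=
    hind.comp (fun i x => w i * x) fun i => measurable_const.mul measurable_id
  have hterm : ∀ i, HasSubgaussianMGF (fun ω => w i * ε i ω) ((w i ^ 2).toNNReal * σ ^ 2) μ := by
    intro i
    refine ((hε i).const_mul (w i)).mono (le_of_eq (NNReal.eq ?_))
    rw [NNReal.coe_mul, NNReal.coe_pow, Real.coe_toNNReal _ (sq_nonneg _)]
    rfl
  have hX : HasSubgaussianMGF (fun ω => ∑ i ∈ s, w i * ε i ω) c.toNNReal μ := by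
    refine (HasSubgaussianMGF.sum_of_iIndepFun hind' fun i _ => hterm i).mono ?_
    rw [← NNReal.coe_le_coe, NNReal.coe_sum, Real.coe_toNNReal _ hc0]
    refine le_of_eq_of_le ?_ hc
    rw [Finset.mul_sum]
    refine Finset.sum_congr rfl fun i _ => ?_
    rw [NNReal.coe_mul, NNReal.coe_pow, Real.coe_toNNReal _ (sq_nonneg _), mul_comm]
  have h1 := hX.measure_ge_le ht
  have h2 := hX.neg.measure_ge_le ht
  have hsub : {ω | t < |∑ i ∈ s, w i * ε i ω|} ⊆ {ω | t ≤ ∑ i ∈ s, w i * ε i ω} ∪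
      {ω | t ≤ (-fun ω => ∑ i ∈ s, w i * ε i ω) ω} := by
    intro ω hω
    rcases lt_abs.1 (show t < |∑ i ∈ s, w i * ε i ω| from hω) with h | h
    · exact Or.inl h.le
    · exact Or.inr h.le
  rw [← ENNReal.ofReal_toReal (measure_ne_top μ _)]
  refine ENNReal.ofReal_le_ofReal ?_
  refine (measureReal_mono hsub).trans ((measureReal_union_le _ _).trans ?_)
  rw [Real.coe_toNNReal _ hc0] at h1 h2
  linarith

open Finset in
/-- With high probability the noise of all local fits is of order `σ √(log n / |I|)`. -/
theorem measure_forall_abs_polyFit_le {q n : ℕ} (hn : 2 ≤ n) {K a : ℝ} (hK : 0 < K) (ha : 0 < a)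
    (hw : ∀ (I : DInterval n) (i : Fin n), i ∈ I.points → ∃ w : Fin n → ℝ,
      (∀ y, polyFit q y I i = ∑ j ∈ I.points, w j * y j) ∧
        ∑ j ∈ I.points, w j ^ 2 ≤ K / I.len)
    {Ω : Type*} [MeasurableSpace Ω] {μ : Measure Ω} [IsProbabilityMeasure μ] {σ : ℝ≥0}
    (hσ : 0 < σ) {ε : Fin n → Ω → ℝ} (hind : iIndepFun ε μ)
    (hε : ∀ i, HasSubgaussianMGF (ε i) (σ ^ 2) μ) :
    ENNReal.ofReal (1 - (n : ℝ) ^ (-a)) ≤ μ {ω | ∀ (I : DInterval n) (i : Fin n), i ∈ I.points →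
      |polyFit q (fun j => ε j ω) I i| ≤
        √(2 * K * (a + 4)) * (σ * √(Real.log n)) * √(1 / I.len)} := by
  classical
  have hn0 : (0 : ℝ) < n := by exact_mod_cast (by omega : 0 < n)
  have hn2 : (2 : ℝ) ≤ n := by exact_mod_cast hn
  have hS : 0 < Real.log n := Real.log_pos (by linarith)
  have hσ' : (0 : ℝ) < σ := by exact_mod_cast hσ
  set G := {ω | ∀ (I : DInterval n) (i : Fin n), i ∈ I.points →
      |polyFit q (fun j => ε j ω) I i| ≤
        √(2 * K * (a + 4)) * (σ * √(Real.log n)) * √(1 / I.len)} with hG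
  -- Indexing by all triples gives the count n³; triples that describe no interval containing the
  -- point yield the empty event.
  let T : Fin n × Fin n × Fin n → Set Ω := fun x =>
    {ω | ∃ I : DInterval n, I.fst = x.1 ∧ I.snd = x.2.1 ∧ x.2.2 ∈ I.points ∧
      √(2 * K * (a + 4)) * (σ * √(Real.log n)) * √(1 / I.len) <
        |polyFit q (fun j => ε j ω) I x.2.2|}
  have hT : ∀ x, μ (T x) ≤ ENNReal.ofReal (2 * (n : ℝ) ^ (-(a + 4))) := by
    rintro ⟨b, c, i⟩
    by_cases h : ∃ I : DInterval n, I.fst = b ∧ I.snd = c ∧ i ∈ I.points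
    · obtain ⟨I, h1, h2, hi⟩ := h
      obtain ⟨w, hw1, hw2⟩ := hw I i hi
      have hlen : (0 : ℝ) < I.len := by exact_mod_cast I.len_pos
      have hsub : T (b, c, i) ⊆ {ω | √(2 * K * (a + 4)) * (σ * √(Real.log n)) * √(1 / I.len) <
          |∑ j ∈ I.points, w j * ε j ω|} := by
        rintro ω ⟨I', h1', h2', -, hlt⟩
        have : I' = I := NonemptyInterval.ext (Prod.ext (h1'.trans h1.symm) (h2'.trans h2.symm))
        subst this
        rw [hw1] at hlt
        exact hlt
      refine (measure_mono hsub).trans ?_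
      -- The threshold t makes t²/(2c) equal to (a + 4) log n.
      have := measure_abs_weighted_sum_gt_le hind hε I.points w
        (c := σ ^ 2 * (K / I.len)) (t := √(2 * K * (a + 4)) * (σ * √(Real.log n)) * √(1 / I.len))
        (by gcongr) (by positivity)
      refine this.trans_eq ?_
      congr 2
      rw [Real.rpow_def_of_pos hn0]
      congr 1
      rw [mul_pow, mul_pow, mul_pow, Real.sq_sqrt (by positivity), Real.sq_sqrt hS.le,
        Real.sq_sqrt (by positivity)]
      field_simp
    · have : T (b, c, i) = ∅ := by
        rw [Set.eq_empty_iff_forall_notMem]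
        rintro ω ⟨I, h1, h2, hi, -⟩
        exact h ⟨I, h1, h2, hi⟩
      rw [this, measure_empty]
      exact zero_le
  -- Subadditivity over a cover replaces complements, so no event has to be measurable.
  have hcover : (Set.univ : Set Ω) ⊆ G ∪ ⋃ x, T x := by
    intro ω _
    by_cases hω : ω ∈ G
    · exact Or.inl hω
    · right
      rw [hG, Set.mem_ofPred_eq] at hω
      push Not at hω
      obtain ⟨I, i, hi, hlt⟩ := hω
      exact Set.mem_iUnion.2 ⟨(I.fst, I.snd, i), I, rfl, rfl, hi, hlt⟩
  have hbad : μ (⋃ x, T x) ≤ ENNReal.ofReal ((n : ℝ) ^ (-a)) := by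
    refine (measure_iUnion_fintype_le μ T).trans ((sum_le_sum fun x _ => hT x).trans ?_)
    rw [sum_const, card_univ, Fintype.card_prod, Fintype.card_prod, Fintype.card_fin,
      nsmul_eq_mul, ← ENNReal.ofReal_natCast, ← ENNReal.ofReal_mul (Nat.cast_nonneg _)]
    refine ENNReal.ofReal_le_ofReal ?_
    have e : (n : ℝ) ^ (-a) = n ^ 4 * (n : ℝ) ^ (-(a + 4)) := by
      rw [← Real.rpow_natCast, ← Real.rpow_add hn0]
      congr 1
      push_cast
      ring
    rw [e]
    have hp : 0 < (n : ℝ) ^ (-(a + 4)) := Real.rpow_pos_of_pos hn0 _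
    push_cast
    calc (n : ℝ) * (n * n) * (2 * (n : ℝ) ^ (-(a + 4)))
        = 2 * n ^ 3 * (n : ℝ) ^ (-(a + 4)) := by ring
      _ ≤ n * n ^ 3 * (n : ℝ) ^ (-(a + 4)) := by gcongr
      _ = _ := by ring
  have htot : 1 ≤ μ G + ENNReal.ofReal ((n : ℝ) ^ (-a)) :=
    calc (1 : ℝ≥0∞) = μ Set.univ := measure_univ.symm
      _ ≤ μ (G ∪ ⋃ x, T x) := measure_mono hcover
      _ ≤ μ G + μ (⋃ x, T x) := measure_union_le _ _
      _ ≤ _ := by gcongr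
  rw [ENNReal.ofReal_sub _ (Real.rpow_nonneg hn0.le _), ENNReal.ofReal_one]
  exact tsub_le_iff_right.2 htot

/-! ### Summation of the pointwise bounds -/

theorem sum_one_div_add_one_le (n : ℕ) :
    ∑ i ∈ Finset.range n, 1 / ((i : ℝ) + 1) ≤ 1 + Real.log n := by
  have h := harmonic_le_one_add_log n
  rw [harmonic] at h
  push_cast at h
  simpa [one_div] using h

theorem sum_one_div_sub_le (n : ℕ) :
    ∑ i ∈ Finset.range n, 1 / ((n : ℝ) - i) ≤ 1 + Real.log n := by
  rw [← Finset.sum_range_reflect]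
  refine (Finset.sum_congr rfl fun i hi => ?_).trans_le (sum_one_div_add_one_le n)
  have hi := Finset.mem_range.1 hi
  have : ((n - 1 - i : ℕ) : ℝ) = n - 1 - i := by
    rw [Nat.cast_sub (by omega), Nat.cast_sub (by omega)]; simp
  rw [this]
  congr 1
  ring

/-- Each radius is either h, giving 1/h, or at most h − 1, giving 1/ℓ ≤ (h − 1)/ℓ². -/
theorem sum_one_div_le_of_scales {n h : ℕ} {ℓ : ℕ → ℕ} (hℓ : ∀ i, 1 ≤ ℓ i ∧ ℓ i ≤ h) :
    ∑ i ∈ Finset.range n, 1 / (ℓ i : ℝ) ≤ n / (h : ℝ) +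
      ((h : ℝ) - 1) * ∑ i ∈ Finset.range n, 1 / (ℓ i : ℝ) ^ 2 := by
  have hterm : ∀ i ∈ Finset.range n, 1 / (ℓ i : ℝ) ≤
      1 / (h : ℝ) + ((h : ℝ) - 1) * (1 / (ℓ i : ℝ) ^ 2) := by
    intro i _
    obtain ⟨h1, h2⟩ := hℓ i
    have p1 : (1 : ℝ) ≤ ℓ i := by exact_mod_cast h1
    rcases h2.eq_or_lt with h2 | h2
    · rw [← h2]
      have : 0 ≤ ((ℓ i : ℝ) - 1) * (1 / (ℓ i : ℝ) ^ 2) :=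
        mul_nonneg (by linarith) (by positivity)
      linarith
    · have p2 : (ℓ i : ℝ) ≤ (h : ℝ) - 1 := by
        have : ((ℓ i + 1 : ℕ) : ℝ) ≤ h := by exact_mod_cast h2
        push_cast at this
        linarith
      have p3 : 1 / (ℓ i : ℝ) = ℓ i * (1 / (ℓ i : ℝ) ^ 2) := by field_simp
      have p4 : (ℓ i : ℝ) * (1 / (ℓ i : ℝ) ^ 2) ≤ ((h : ℝ) - 1) * (1 / (ℓ i : ℝ) ^ 2) := by
        gcongr
      have p5 : (0 : ℝ) ≤ 1 / (h : ℝ) := by positivity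
      linarith
  refine (Finset.sum_le_sum hterm).trans_eq ?_
  rw [Finset.sum_add_distrib, Finset.sum_const, Finset.card_range, nsmul_eq_mul, mul_one_div,
    Finset.mul_sum]

theorem sq_le_of_abs_le_add {e x₁ x₂ x₃ x₄ : ℝ} (h : |e| ≤ x₁ + x₂ + x₃ + x₄) :
    e ^ 2 ≤ 4 * (x₁ ^ 2 + x₂ ^ 2 + x₃ ^ 2 + x₄ ^ 2) := by
  have h1 : e ^ 2 ≤ (x₁ + x₂ + x₃ + x₄) ^ 2 := by
    rw [← sq_abs]
    exact pow_le_pow_left₀ (abs_nonneg _) h 2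
  nlinarith [sq_nonneg (x₁ - x₂), sq_nonneg (x₁ - x₃), sq_nonneg (x₁ - x₄), sq_nonneg (x₂ - x₃),
    sq_nonneg (x₂ - x₄), sq_nonneg (x₃ - x₄)]

/-- The deterministic error bound on the event where the noise of all local fits is small. -/
theorem sum_sq_sub_le {q n : ℕ} (hn : 2 ≤ n) {K A C₁ M lam σ : ℝ}
    (hK : 1 ≤ K) (hA : 0 ≤ A) (hC₁ : 1 ≤ C₁) (hlam : 0 < lam) (hσ : 0 < σ)
    (hw : ∀ (I : DInterval n) (i : Fin n), i ∈ I.points → ∃ w : Fin n → ℝ,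
      (∀ y, polyFit q y I i = ∑ j ∈ I.points, w j * y j) ∧
        ∑ j ∈ I.points, w j ^ 2 ≤ K / I.len)
    {θ ε est : Fin n → ℝ} (hest : IsMinmaxTF q lam (fun j => θ j + ε j) est)
    (hnoise : ∀ (I : DInterval n) (i : Fin n), i ∈ I.points →
      |polyFit q ε I i| ≤ A * (σ * √(Real.log n)) * √(1 / I.len))
    (hlam_le : lam ^ 2 ≤ C₁ * (n * (σ ^ 2 * Real.log n)))
    (hV : lam * √(Real.log n) * (lam ^ 2 / (σ ^ 2 * Real.log n)) ^ q * totalVar (q + 1) θ ≤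
      M * ((n : ℝ) ^ q * (n * σ ^ 4 * Real.log n ^ 3 / lam ^ 2))) :
    ∑ i, (est i - θ i) ^ 2 ≤
      4 * ((((√K + 1) * 2 ^ q) ^ 2 + 2) * (C₁ ^ 2 + 400 * 2 ^ q * M) + 2 * A ^ 4 +
        A ^ 2 * (8 * C₁ + 2 * (C₁ ^ 2 + 400 * 2 ^ q * M))) *
      (n * σ ^ 4 * Real.log n ^ 3 / lam ^ 2) := by
  have hn0 : (0 : ℝ) < n := by exact_mod_cast (by omega : 0 < n)
  have hS2 : 1 ≤ 2 * Real.log n := by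
    have h1 : Real.log 2 ≤ Real.log n := Real.log_le_log (by norm_num) (by exact_mod_cast hn)
    have h2 := Real.log_two_gt_d9
    linarith
  have hharm1 := sum_one_div_add_one_le n
  have hharm2 := sum_one_div_sub_le n
  set S := Real.log n with hSdef
  clear_value S
  have hS : 0 < S := by linarith
  have hsS : 0 < √S := Real.sqrt_pos.2 hS
  have hsS2 : √S ^ 2 = S := Real.sq_sqrt hS.le
  set T := n * σ ^ 4 * S ^ 3 / lam ^ 2 with hT
  clear_value T
  have hT0 : 0 < T := by rw [hT]; positivity
  -- The length at which penalty and noise balance: λ/H = σ√(S/H).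
  set H := lam ^ 2 / (σ ^ 2 * S) with hH
  clear_value H
  have hH0 : 0 < H := by rw [hH]; positivity
  have hHn : H ≤ C₁ * n := by
    rw [hH, div_le_iff₀ (by positivity)]
    linarith
  set h := min ⌈H⌉₊ n with hh
  have hh1 : 1 ≤ h := le_min (Nat.one_le_iff_ne_zero.2 (Nat.ceil_pos.2 hH0).ne') (by omega)
  have hhn : h ≤ n := min_le_right _ _
  have hhH : (h : ℝ) - 1 ≤ H := by
    have h1 : (h : ℝ) ≤ ⌈H⌉₊ := by exact_mod_cast min_le_left _ _
    have h2 := Nat.ceil_lt_add_one hH0.le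
    linarith
  have hh0 : (1 : ℝ) ≤ h := by exact_mod_cast hh1
  have hHh : H ≤ C₁ * h := by
    rcases min_choice ⌈H⌉₊ n with h1 | h1
    · have h2 : H ≤ h := by rw [hh, h1]; exact Nat.le_ceil H
      nlinarith
    · rw [hh, h1]; exact hHn
  clear_value h
  set d : ℕ → ℝ := fun j => |(fwdDiff 1)^[q + 1] (extendZero θ) j| with hd
  set D := ∑ j ∈ Finset.range (n - (q + 1)), d j with hD
  have hVD : totalVar (q + 1) θ = (n : ℝ) ^ q * D := totalVar_eq_sum_range q θ
  have hD0 : 0 ≤ D := Finset.sum_nonneg fun _ _ => abs_nonneg _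
  -- The threshold λ√S allows a bias of order λ√S/ℓ, larger than the penalty error λ/ℓ by the factor
  -- √S.
  obtain ⟨ℓ, hℓ, hsum⟩ := exists_scales (q := q) (n := n) (h := h) (d := d)
    (fun j => abs_nonneg _) (mul_pos hlam hsS) hh1
  set W := ∑ i ∈ Finset.range n, 1 / (ℓ i : ℝ) ^ 2 with hW
  have hW0 : 0 ≤ W := Finset.sum_nonneg fun _ _ => by positivity
  set M₁ := C₁ ^ 2 + 400 * 2 ^ q * M with hM₁
  clear_value W M₁
  have hWM : lam ^ 2 * S * W ≤ M₁ * T := by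
    have h1 : (n : ℝ) / (h : ℝ) ^ 2 ≤ C₁ ^ 2 * n / H ^ 2 := by
      rw [div_le_div_iff₀ (by positivity) (by positivity)]
      have : H ^ 2 ≤ (C₁ * h) ^ 2 := pow_le_pow_left₀ hH0.le hHh 2
      calc (n : ℝ) * H ^ 2 ≤ n * (C₁ * h) ^ 2 := by gcongr
        _ = _ := by ring
    have h2 : 400 * (2 * ((h : ℝ) - 1)) ^ q * D / (lam * √S) ≤
        400 * (2 * H) ^ q * D / (lam * √S) := by
      have : 0 ≤ 2 * ((h : ℝ) - 1) := by linarith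
      gcongr
    have h3 : lam ^ 2 * S * (C₁ ^ 2 * n / H ^ 2) = C₁ ^ 2 * T := by
      rw [hH, hT]
      field_simp
    have h4 : lam ^ 2 * S * (400 * (2 * H) ^ q * D / (lam * √S)) =
        400 * 2 ^ q * (lam * √S * H ^ q * D) := by
      nth_rewrite 1 [← hsS2]
      rw [mul_pow]
      field_simp
    have h5 : lam * √S * H ^ q * D ≤ M * T := by
      rw [hVD] at hV
      have hnq : (0 : ℝ) < (n : ℝ) ^ q := by positivity
      refine le_of_mul_le_mul_left ?_ hnq
      linarith
    have h6 : (0 : ℝ) ≤ 400 * 2 ^ q := by positivity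
    calc lam ^ 2 * S * W ≤ lam ^ 2 * S * (C₁ ^ 2 * n / H ^ 2 +
          400 * (2 * H) ^ q * D / (lam * √S)) := by gcongr; linarith
      _ = C₁ ^ 2 * T + 400 * 2 ^ q * (lam * √S * H ^ q * D) := by rw [mul_add, h3, h4]
      _ ≤ C₁ ^ 2 * T + 400 * 2 ^ q * (M * T) := by gcongr
      _ = M₁ * T := by rw [hM₁]; ring
  have hW1 : ∑ i ∈ Finset.range n, 1 / (ℓ i : ℝ) ≤ C₁ * n / H + H * W := by
    refine (sum_one_div_le_of_scales fun i => ⟨(hℓ i).1, (hℓ i).2.1⟩).trans ?_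
    refine add_le_add ?_ (by rw [← hW]; exact mul_le_mul_of_nonneg_right hhH hW0)
    rw [div_le_div_iff₀ (by positivity) hH0]
    nlinarith
  set Kb := (√K + 1) * 2 ^ q with hKb
  have hKb0 : 0 ≤ Kb := by positivity
  clear_value Kb
  set N := A * (σ * √S) with hN
  have hN0 : 0 ≤ N := by positivity
  clear_value N
  have hN2 : N ^ 2 = A ^ 2 * (σ ^ 2 * S) := by rw [hN, mul_pow, mul_pow, hsS2]
  have hpt : ∀ i : Fin n, (est i - θ i) ^ 2 ≤
      4 * ((Kb ^ 2 + 2) * (lam ^ 2 * S) * (1 / (ℓ i : ℝ) ^ 2) + A ^ 4 * (σ ^ 4 * S ^ 2 / lam ^ 2) +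
        A ^ 2 * (σ ^ 2 * S) * (1 / (ℓ i : ℝ) + 1 / ((i : ℕ) + 1 : ℝ) +
          1 / ((n : ℝ) - (i : ℕ)))) := by
    intro i
    obtain ⟨hℓ1, hℓh, hℓμ⟩ := hℓ i
    have hℓ0 : (0 : ℝ) < ℓ i := by exact_mod_cast hℓ1
    have hbias : ∀ I : DInterval n, i ∈ I.points → I ≤ window i (ℓ i) →
        |polyFit q θ I i - θ i| ≤ Kb * (lam * √S / ℓ i) := by
      intro I hi hI
      refine (abs_polyFit_sub_le hI hi (hw I i hi)).trans ?_
      have : (ℓ i : ℝ) ^ q * localVar q n d i (ℓ i) ≤ lam * √S / ℓ i := by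
        rw [le_div_iff₀ hℓ0]
        rw [pow_succ] at hℓμ
        linarith
      calc (√K + 1) * ((2 * ℓ i : ℝ) ^ q * localVar q n d i (ℓ i))
          = Kb * ((ℓ i : ℝ) ^ q * localVar q n d i (ℓ i)) := by rw [hKb, mul_pow]; ring
        _ ≤ _ := by gcongr
    have hsq := sq_le_of_abs_le_add
      (abs_sub_le_of_window hlam hN0 hest hℓ1 (hℓh.trans hhn) hbias fun I hi => hnoise I i hi)
    have hni : (0 : ℝ) < (n : ℝ) - (i : ℕ) := by
      have : ((i : ℕ) : ℝ) < n := by exact_mod_cast i.isLt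
      linarith
    have e1 : (Kb * (lam * √S / ℓ i)) ^ 2 = Kb ^ 2 * (lam ^ 2 * S) * (1 / (ℓ i : ℝ) ^ 2) := by
      have : (Kb * (lam * √S / ℓ i)) ^ 2 = Kb ^ 2 * (lam ^ 2 * √S ^ 2) * (1 / (ℓ i : ℝ) ^ 2) := by
        ring
      rw [this, hsS2]
    have e2 : (N ^ 2 / lam) ^ 2 = A ^ 4 * (σ ^ 4 * S ^ 2 / lam ^ 2) := by
      rw [hN2]; ring
    have e3 : (lam / ℓ i) ^ 2 ≤ 2 * (lam ^ 2 * S) * (1 / (ℓ i : ℝ) ^ 2) := by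
      rw [div_pow, div_eq_mul_one_div]
      have : lam ^ 2 ≤ 2 * S * lam ^ 2 := le_mul_of_one_le_left (sq_nonneg _) hS2
      exact mul_le_mul_of_nonneg_right (by linarith) (by positivity)
    rw [e1, e2, mul_pow, Real.sq_sqrt (by positivity), hN2] at hsq
    linarith
  have hsumR : ∑ i ∈ Finset.range n, (1 / (ℓ i : ℝ) + 1 / ((i : ℝ) + 1) + 1 / ((n : ℝ) - i)) ≤
      C₁ * n / H + H * W + 6 * S := by
    -- The two boundary sums give 2(1 + S) ≤ 6S, as 1 ≤ 2S.
    rw [Finset.sum_add_distrib, Finset.sum_add_distrib]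
    linarith
  have f1 : n * (σ ^ 4 * S ^ 2 / lam ^ 2) ≤ 2 * T := by
    have : 2 * T = (2 * S) * (n * (σ ^ 4 * S ^ 2 / lam ^ 2)) := by rw [hT]; ring
    rw [this]
    exact le_mul_of_one_le_left (by positivity) hS2
  have f2 : σ ^ 2 * S * (C₁ * n / H + H * W + 6 * S) ≤ (8 * C₁ + 2 * M₁) * T := by
    have g1 : σ ^ 2 * S * (C₁ * n / H) = C₁ * (n * (σ ^ 4 * S ^ 2 / lam ^ 2)) := by
      rw [hH]; field_simp
    have g2 : σ ^ 2 * S * (H * W) = lam ^ 2 * W := by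
      rw [hH]; field_simp
    have g3 : lam ^ 2 * W ≤ 2 * (M₁ * T) := by
      have : lam ^ 2 * W ≤ (2 * S) * (lam ^ 2 * W) := le_mul_of_one_le_left (by positivity) hS2
      linarith
    have g4 : σ ^ 2 * S * S ≤ C₁ * T := by
      rw [hT, mul_div_assoc', le_div_iff₀ (by positivity)]
      calc σ ^ 2 * S * S * lam ^ 2 ≤ σ ^ 2 * S * S * (C₁ * (n * (σ ^ 2 * S))) := by gcongr
        _ = _ := by ring
    have g5 : C₁ * (n * (σ ^ 4 * S ^ 2 / lam ^ 2)) ≤ C₁ * (2 * T) := by gcongr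
    rw [mul_add, mul_add, g1, g2]
    linarith
  calc ∑ i, (est i - θ i) ^ 2 ≤ _ := Finset.sum_le_sum fun i _ => hpt i
    _ = 4 * ((Kb ^ 2 + 2) * (lam ^ 2 * S * W) + A ^ 4 * (n * (σ ^ 4 * S ^ 2 / lam ^ 2)) +
        A ^ 2 * (σ ^ 2 * S * ∑ i ∈ Finset.range n,
          (1 / (ℓ i : ℝ) + 1 / ((i : ℝ) + 1) + 1 / ((n : ℝ) - i)))) := by
      rw [Fin.sum_univ_eq_sum_range (fun i => 4 * ((Kb ^ 2 + 2) * (lam ^ 2 * S) *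
        (1 / (ℓ i : ℝ) ^ 2) + A ^ 4 * (σ ^ 4 * S ^ 2 / lam ^ 2) +
        A ^ 2 * (σ ^ 2 * S) * (1 / (ℓ i : ℝ) + 1 / ((i : ℝ) + 1) + 1 / ((n : ℝ) - i)))) n,
        ← Finset.mul_sum, Finset.sum_add_distrib, Finset.sum_add_distrib, ← Finset.mul_sum,
        ← Finset.mul_sum, Finset.sum_const, Finset.card_range, nsmul_eq_mul, ← Finset.mul_sum, hW]
      ring
    _ ≤ 4 * ((Kb ^ 2 + 2) * (M₁ * T) + A ^ 4 * (2 * T) +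
        A ^ 2 * ((8 * C₁ + 2 * M₁) * T)) := by
      have := mul_le_mul_of_nonneg_left hsumR (by positivity : 0 ≤ σ ^ 2 * S)
      have h1 := mul_le_mul_of_nonneg_left hWM (by positivity : 0 ≤ Kb ^ 2 + 2)
      have h2 := mul_le_mul_of_nonneg_left f1 (by positivity : 0 ≤ A ^ 4)
      have h3 := mul_le_mul_of_nonneg_left (this.trans f2) (by positivity : 0 ≤ A ^ 2)
      linarith
    _ = _ := by ring

/-! ### Tuning parameter and conclusion -/

/-- Identities for the tuning parameter. -/
theorem tuning_identities {κ x V s S : ℝ} (hκ : 0 < κ) (hx : 0 < x) (hV : 0 < V)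
    (hs : 0 < s) (hS : 0 < S) (q : ℕ) {r lam : ℝ} (hr : r = q + 1)
    (hlam : lam = κ * x ^ (r / (2 * r + 1)) * V ^ (-(1 : ℝ) / (2 * r + 1)) *
      s ^ (1 + (1 : ℝ) / (2 * r + 1)) * S ^ ((1 : ℝ) / 2 + (1 : ℝ) / (2 * r + 1))) :
    0 < lam ∧
    lam ^ (2 * q + 3) * V =
      κ ^ (2 * q + 3) * (√x * (s * √S)) ^ (2 * q + 3) * (s * S / √x) ∧
    lam * √S * (lam ^ 2 / (s ^ 2 * S)) ^ q * V =
      κ ^ (2 * q + 3) * (x ^ q * (x * s ^ 4 * S ^ 3 / lam ^ 2)) ∧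
    1 / x ^ ((2 * r) / (2 * r + 1)) * V ^ ((2 : ℝ) / (2 * r + 1)) *
      (s ^ 2 * S ^ 2) ^ ((2 * r) / (2 * r + 1)) = κ ^ 2 * (s ^ 4 * S ^ 3 / lam ^ 2) := by
  have hr0 : 2 * r + 1 ≠ 0 := by rw [hr]; positivity
  -- Once every quantity is an exponential, the identities compare exponents, with common
  -- denominator m = 2r + 1.
  obtain ⟨κ, rfl⟩ : ∃ t, κ = Real.exp t := ⟨_, (Real.exp_log hκ).symm⟩
  obtain ⟨x, rfl⟩ : ∃ t, x = Real.exp t := ⟨_, (Real.exp_log hx).symm⟩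
  obtain ⟨V, rfl⟩ : ∃ t, V = Real.exp t := ⟨_, (Real.exp_log hV).symm⟩
  obtain ⟨s, rfl⟩ : ∃ t, s = Real.exp t := ⟨_, (Real.exp_log hs).symm⟩
  obtain ⟨S, rfl⟩ : ∃ t, S = Real.exp t := ⟨_, (Real.exp_log hS).symm⟩
  subst hlam
  obtain ⟨m, hm⟩ : ∃ m, m = 2 * r + 1 := ⟨_, rfl⟩
  have hq : (q : ℝ) = (m - 3) / 2 := by rw [hm, hr]; ring
  have hrm : r = (m - 1) / 2 := by rw [hm]; ring
  rw [← hm] at hr0 ⊢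
  rw [hrm]
  refine ⟨by positivity, ?_, ?_, ?_⟩ <;>
  · simp only [Real.sqrt_eq_rpow, one_div, ← Real.exp_mul, ← Real.exp_add, ← Real.exp_nat_mul,
      ← Real.exp_sub, ← Real.exp_neg]
    congr 1
    push_cast
    try rw [hq]
    field_simp
    ring

/-- The lower bound on the total variation bounds the tuning parameter. -/
theorem sq_tuning_le {Z lam V x y c₀ B : ℝ} {p : ℕ} (hp : 1 ≤ p) (hx : 0 < x)
    (hy : 0 ≤ y) (hc₀ : 0 < c₀) (hZ1 : 1 ≤ Z) (hZ : B / c₀ ≤ Z) (hlam : 0 < lam)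
    (hV : c₀ * x ≤ V) (h : lam ^ p * V = B * y ^ p * x) : lam ^ 2 ≤ Z ^ 2 * y ^ 2 := by
  have h1 : lam ^ p ≤ (Z * y) ^ p := by
    have h2 : lam ^ p * (c₀ * x) ≤ B * y ^ p * x := by rw [← h]; gcongr
    have h3 : lam ^ p * c₀ ≤ B * y ^ p := by
      refine le_of_mul_le_mul_right ?_ hx
      linarith
    calc lam ^ p ≤ B * y ^ p / c₀ := by rw [le_div_iff₀ hc₀]; exact h3
      _ = B / c₀ * y ^ p := by ring
      _ ≤ Z * y ^ p := by gcongr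
      _ ≤ Z ^ p * y ^ p := by
        gcongr
        exact le_self_pow₀ hZ1 (by omega)
      _ = _ := by rw [mul_pow]
  have h2 : lam ≤ Z * y := le_of_pow_le_pow_left₀ (by omega) (by positivity) h1
  calc lam ^ 2 ≤ (Z * y) ^ 2 := by gcongr
    _ = _ := by rw [mul_pow]

theorem mainTheorem7 (r : ℕ) (hr : 1 ≤ r) (κ : ℝ) (hκ : 0 < κ) (c₀ : ℝ) (hc₀ : 0 < c₀)
    (a : ℝ) (ha : 0 < a) :
    ∃ C : ℝ, 0 < C ∧
      ∀ (n : ℕ), 2 ≤ n →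
      ∀ (Ω : Type*) [MeasurableSpace Ω] (μ : Measure Ω) [IsProbabilityMeasure μ]
        (σ : ℝ≥0) (ε : Fin n → Ω → ℝ) (θ : Fin n → ℝ) (V lam : ℝ),
        0 < σ →
        (∀ i, Measurable (ε i)) →
        iIndepFun ε μ →
        (∀ i, HasSubgaussianMGF (ε i) (σ ^ 2) μ) →
        V = totalVar r θ →
        c₀ * (σ * Real.log n / Real.sqrt n) ≤ V →
        lam = κ * (n : ℝ) ^ ((r : ℝ) / (2 * r + 1)) * V ^ (-(1 : ℝ) / (2 * r + 1))
          * (σ : ℝ) ^ (1 + (1 : ℝ) / (2 * r + 1))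
          * (Real.log n) ^ ((1 : ℝ) / 2 + (1 : ℝ) / (2 * r + 1)) →
        ENNReal.ofReal (1 - (n : ℝ) ^ (-a)) ≤
          μ {ω | ∀ est : Fin n → ℝ, IsMinmaxTF (r - 1) lam (fun i => θ i + ε i ω) est →
            meanSqErr est θ ≤
              C * (1 / (n : ℝ) ^ ((2 * r : ℝ) / (2 * r + 1))) * V ^ ((2 : ℝ) / (2 * r + 1))
                * ((σ : ℝ) ^ 2 * (Real.log n) ^ 2) ^ ((2 * r : ℝ) / (2 * r + 1))} := by
  obtain ⟨q, rfl⟩ : ∃ q, r = q + 1 := ⟨r - 1, by omega⟩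
  obtain ⟨K, hK1, hw⟩ := exists_polyFit_weights q
  set A := √(2 * K * (a + 4)) with hA
  -- Z² plays the role of C₁ in `sum_sq_sub_le`; taking Z ≥ 1 avoids a root of order 2q + 3.
  set Z := max 1 (κ ^ (2 * q + 3) / c₀) with hZ
  set M := κ ^ (2 * q + 3) with hM
  set B := 4 * ((((√K + 1) * 2 ^ q) ^ 2 + 2) * ((Z ^ 2) ^ 2 + 400 * 2 ^ q * M) + 2 * A ^ 4 +
        A ^ 2 * (8 * Z ^ 2 + 2 * ((Z ^ 2) ^ 2 + 400 * 2 ^ q * M))) with hB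
  have hZ1 : 1 ≤ Z := le_max_left _ _
  have hB0 : 0 < B := by positivity
  refine ⟨B / κ ^ 2, by positivity, ?_⟩
  intro n hn Ω _ μ _ σ ε θ V lam hσ _ hind hsub hVdef hV hlam
  have hn0 : (0 : ℝ) < n := by exact_mod_cast (by omega : 0 < n)
  have hS : 0 < Real.log n := Real.log_pos (by exact_mod_cast (by omega : 1 < n))
  have hσ' : (0 : ℝ) < σ := by exact_mod_cast hσ
  have hx : 0 < σ * Real.log n / √n := by positivity
  have hV0 : 0 < V := (mul_pos hc₀ hx).trans_le hV
  obtain ⟨hlam0, hid1, hid2, hid3⟩ := tuning_identities hκ hn0 hV0 hσ' hS q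
    (r := ((q + 1 : ℕ) : ℝ)) (by push_cast; ring) hlam
  have hlam_le : lam ^ 2 ≤ Z ^ 2 * (n * (σ ^ 2 * Real.log n)) := by
    have := sq_tuning_le (by omega) hx (by positivity) hc₀ hZ1 (le_max_right _ _) hlam0 hV
      hid1
    rwa [mul_pow √(n : ℝ), mul_pow (σ : ℝ), Real.sq_sqrt hn0.le, Real.sq_sqrt hS.le] at this
  -- The noise event does not involve `est`, so one event serves all fits.
  refine (measure_forall_abs_polyFit_le hn (by linarith : 0 < K) ha (fun I i hi => hw n I i hi)
    hσ hind hsub).trans (measure_mono fun ω hω est hest => ?_)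
  have hmain := sum_sq_sub_le hn hK1 (Real.sqrt_nonneg _) (one_le_pow₀ hZ1) hlam0 hσ'
    (fun I i hi => hw n I i hi) hest hω hlam_le (by rw [← hVdef]; exact hid2.le)
  rw [meanSqErr]
  calc 1 / (n : ℝ) * ∑ i, (est i - θ i) ^ 2
      ≤ 1 / (n : ℝ) * (B * (n * σ ^ 4 * Real.log n ^ 3 / lam ^ 2)) := by gcongr
    _ = B / κ ^ 2 * (κ ^ 2 * (σ ^ 4 * Real.log n ^ 3 / lam ^ 2)) := by field_simp
    _ = _ := by rw [← hid3]; ring
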